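/- Let $d\ge 2$. Write $\mathcal F$ for the Fourier transform on $\mathcal S'(\mathbb R^d)$, normalized by $\mathcal F\varphi(\xi)=(2\pi)^{-d/2}\int_{\mathbb R^d}e^{-ix\cdot\xi}\varphi(x)\,dx$ on $\mathcal S(\mathbb R^d)$. Fix a non-negative $\phi_0\in\mathcal S(\mathbb R^d)$ with $\phi_0(x)=1$ for $|x|\le 1$ and $\phi_0(x)=0$ for $|x|\ge \frac32$, and put $\phi_j(x)=\phi_0(2^{-j}x)-\phi_0(2^{-j+1}x)$ for $j\ge 1$. Fix $\varphi_0\in C_0^\infty(\mathbb R)$ with $\varphi_0=1$ on $[-1,1]$ and $\operatorname{supp}\varphi_0\subset[-\frac32,\frac32]$, put $\varphi_j(\xi)=\varphi_0(2^{-j}\xi)-\varphi_0(2^{-j+1}\xi)$ for $j\ge1$, and for $k\in\mathbb N_0^d$ put $\varphi_k(x)=\prod_{i=1}^d\varphi_{k_i}(x_i)$ and $|k|_1=k_1+\dots+k_d$. For $0<p<\infty$, $0<q\le\infty$ and $t\in\mathbb R$, the isotropic Lizorkin–Triebel space $F^t_{p,q}(\mathbb R^d)$ and the Lizorkin–Triebel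 space of dominating mixed smoothness $S^t_{p,q}F(\mathbb R^d)$ consist of all $f\in\mathcal S'(\mathbb R^d)$ for which, respectively, the quasi-norms $$\|f\,|F^t_{p,q}\|=\Big\|\Big(\sum_{j=0}^\infty 2^{jtq}\,|\mathcal F^{-1}[\phi_j\mathcal Ff]|^q\Big)^{1/q}\Big|L_p(\mathbb R^d)\Big\|,\qquad \|f\,|S^t_{p,q}F\|=\Big\|\Big(\sum_{k\in\mathbb N_0^d}2^{|k|_1tq}\,|\mathcal F^{-1}[\varphi_k\mathcal Ff]|^q\Big)^{1/q}\Big|L_p(\mathbb R^d)\Big\|$$ are finite (with a supremum in place of the sum if $q=\infty$). Write $X\hookrightarrow Y$ if $X\subset Y$ and the inclusion is continuous, i.e. $\|f|Y\|\le C\,\|f|X\|$ for all $f\in X$ with a constant $C<\infty$. **Theorem 3.13.** Let $0<p<\infty$, $0<q\le\infty$ and $t\in\mathbb R$ be fixed. Then for all $0<p_0<\infty$, $0<q_0\le\infty$ and $t_0\in\mathbb R$, $$F^{td}_{p,q}(\mathbb R^d)\hookrightarrow S^{t_0}_{p_0,q_0}F(\mathbb R^d)\quad\Longrightarrow\quad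 S^t_{p,q}F(\mathbb R^d)\hookrightarrow S^{t_0}_{p_0,q_0}F(\mathbb R^d).$$ That is, $S^t_{p,q}F(\mathbb R^d)$ is contained, with continuous inclusion, in every space $S^{t_0}_{p_0,q_0}F(\mathbb R^d)$ into which $F^{td}_{p,q}(\mathbb R^d)$ embeds; in this sense it is the smallest of them. -/

import Mathlib

open MeasureTheory
open scoped ENNReal NNReal SchwartzMap ContDiff

namespace MixedSmoothness

/-- The Euclidean space `ℝ^d`. -/
abbrev Rd (d : ℕ) : Type := EuclideanSpace ℝ (Fin d)

/-! ### Tempered distributions given by functions -/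

/-- The tempered distribution `T` is (given by) the function `g`:
`T u = ∫ u g` for all Schwartz functions `u`, the integrals being absolutely convergent. -/
def IsGivenBy {d : ℕ} (T : 𝓢'(Rd d, ℂ)) (g : Rd d → ℂ) : Prop :=
  ∀ u : 𝓢(Rd d, ℂ), Integrable (fun x => u x * g x) ∧ T u = ∫ x, u x * g x

/-- The distribution `𝓕⁻¹[m 𝓕 f]`, where `𝓕` is the Fourier transform in the normalization
`(𝓕 φ)(ξ) = (2π)^{-d/2} ∫ e^{-i x·ξ} φ(x) dx`.  Mathlib uses the kernel `e^{-2π i x·ξ}`;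
the substitution `ξ ↦ 2π ξ` in the symbol translates one normalization exactly into the other. -/
noncomputable def multiplier {d : ℕ} (m : Rd d → ℂ) (f : 𝓢'(Rd d, ℂ)) : 𝓢'(Rd d, ℂ) :=
  TemperedDistribution.fourierMultiplierCLM ℂ (fun ξ => m ((2 * Real.pi) • ξ)) f

/-! ### The `L_p(ℓ_q)` quasi-norm -/

/-- The `ℓ_q` quasi-norm, `0 < q ≤ ∞`, of a family in `[0, ∞]`. -/
noncomputable def lqNorm {ι : Type} (q : ℝ≥0∞) (a : ι → ℝ≥0∞) : ℝ≥0∞ :=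
  if q = ⊤ then ⨆ k, a k else (∑' k, a k ^ q.toReal) ^ (1 / q.toReal)

/-- `‖ ( ∑_k |w_k g_k|^q )^{1/q} | L_p(ℝ^d) ‖`, for `0 < p < ∞` and weights `w_k ≥ 0`. -/
noncomputable def LpLqNorm {d : ℕ} {ι : Type} (p : ℝ) (q : ℝ≥0∞) (w : ι → ℝ≥0∞)
    (g : ι → Rd d → ℂ) : ℝ≥0∞ :=
  (∫⁻ x, (lqNorm q (fun k => w k * ‖g k x‖ₑ)) ^ p) ^ (1 / p)

/-- The `L_p(ℓ_q)` quasi-norm of a family of tempered distributions which are functions.  The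
functions are determined up to null sets, so the infimum runs over one value only
(see `distLpLqNorm_eq`). -/
noncomputable def distLpLqNorm {d : ℕ} {ι : Type} (p : ℝ) (q : ℝ≥0∞) (w : ι → ℝ≥0∞)
    (T : ι → 𝓢'(Rd d, ℂ)) : ℝ≥0∞ :=
  ⨅ (g : ι → Rd d → ℂ) (_ : ∀ k, IsGivenBy (T k) (g k)), LpLqNorm p q w g

/-! ### Smooth dyadic decompositions of unity -/

/-- `φ_0 = φ₀` and `φ_j = φ₀(2^{-j} ·) - φ₀(2^{-j+1} ·)` for `j ≥ 1`. -/
noncomputable def dyadic {V : Type} [AddCommGroup V] [Module ℝ V] (φ₀ : V → ℂ) : ℕ → V → ℂ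
  | 0 => φ₀
  | j + 1 => fun x => φ₀ (((2 : ℝ) ^ (j + 1))⁻¹ • x) - φ₀ (((2 : ℝ) ^ j)⁻¹ • x)

/-- Generators of an isotropic decomposition: non-negative Schwartz functions on `ℝ^d`, equal to
`1` for `|x| ≤ 1` and to `0` for `|x| ≥ 3/2`. -/
structure IsIsotropicGenerator {d : ℕ} (φ₀ : 𝓢(Rd d, ℝ)) : Prop where
  nonneg : ∀ x, 0 ≤ φ₀ x
  eq_one : ∀ x, ‖x‖ ≤ 1 → φ₀ x = 1
  eq_zero : ∀ x, 3 / 2 ≤ ‖x‖ → φ₀ x = 0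

/-- Generators of a tensor product decomposition: smooth functions on `ℝ`, equal to `1` on
`[-1, 1]` and with support in `[-3/2, 3/2]`. -/
structure IsUnivariateGenerator (η₀ : ℝ → ℂ) : Prop where
  smooth : ContDiff ℝ ∞ η₀
  eq_one : ∀ x ∈ Set.Icc (-1 : ℝ) 1, η₀ x = 1
  tsupport_subset : tsupport η₀ ⊆ Set.Icc (-(3 / 2) : ℝ) (3 / 2)

/-- `φ_j`, `j ∈ ℕ₀`, on `ℝ^d`. -/
noncomputable def isoSymbol {d : ℕ} (φ₀ : 𝓢(Rd d, ℝ)) (j : ℕ) : Rd d → ℂ :=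
  dyadic (fun x => (φ₀ x : ℂ)) j

/-- `η_k(x) = η_{k_1}(x_1) ⋯ η_{k_d}(x_d)`, `k ∈ ℕ₀^d`. -/
noncomputable def mixSymbol {d : ℕ} (η₀ : ℝ → ℂ) (k : Fin d → ℕ) : Rd d → ℂ :=
  fun x => ∏ i, dyadic η₀ (k i) (x i)

/-! ### Lizorkin-Triebel spaces -/

/-- The quasi-norm of the isotropic Lizorkin-Triebel space `F^t_{p,q}(ℝ^d)`. -/
noncomputable def normF {d : ℕ} (φ₀ : 𝓢(Rd d, ℝ)) (t p : ℝ) (q : ℝ≥0∞)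
    (f : 𝓢'(Rd d, ℂ)) : ℝ≥0∞ :=
  distLpLqNorm p q (fun j : ℕ => (2 : ℝ≥0∞) ^ ((j : ℝ) * t))
    (fun j => multiplier (isoSymbol φ₀ j) f)

/-- The quasi-norm of the Lizorkin-Triebel space of dominating mixed smoothness
`S^t_{p,q}F(ℝ^d)`. -/
noncomputable def normSF {d : ℕ} (η₀ : ℝ → ℂ) (t p : ℝ) (q : ℝ≥0∞)
    (f : 𝓢'(Rd d, ℂ)) : ℝ≥0∞ :=
  distLpLqNorm p q (fun k : Fin d → ℕ => (2 : ℝ≥0∞) ^ (((∑ i, k i : ℕ) : ℝ) * t))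
    (fun k => multiplier (mixSymbol η₀ k) f)

/-- The space of all tempered distributions with finite quasi-norm `N`. -/
def space {d : ℕ} (N : 𝓢'(Rd d, ℂ) → ℝ≥0∞) : Set 𝓢'(Rd d, ℂ) := {f | N f < ⊤}

/-- Continuous embedding of the space with quasi-norm `N` into the one with quasi-norm `M`:
inclusion, with the identity map bounded (that is, continuous) for the quasi-norms. -/
def Embeds {d : ℕ} (N M : 𝓢'(Rd d, ℂ) → ℝ≥0∞) : Prop :=
  space N ⊆ space M ∧ ∃ C : ℝ≥0, ∀ f ∈ space N, M f ≤ C * N f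

/-! ### The definitions make sense -/

/-- The function representing a distribution is unique up to null sets. -/
theorem IsGivenBy.ae_eq {d : ℕ} {T : 𝓢'(Rd d, ℂ)} {g h : Rd d → ℂ}
    (hg : IsGivenBy T g) (hh : IsGivenBy T h) : g =ᵐ[volume] h := by
  have key : ∀ {g : Rd d → ℂ}, IsGivenBy T g → LocallyIntegrable g := by
    intro g hg
    rw [locallyIntegrable_iff]
    intro K hK
    obtain ⟨R, hR⟩ := hK.isBounded.subset_closedBall (0 : Rd d)
    let B : ContDiffBump (0 : Rd d) := ⟨max R 1, max R 1 + 1, by positivity, by linarith⟩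
    have hBc : HasCompactSupport (Complex.ofRealCLM ∘ B) := B.hasCompactSupport.comp_left rfl
    have hBs : ContDiff ℝ ∞ (Complex.ofRealCLM ∘ B) :=
      Complex.ofRealCLM.contDiff.comp B.contDiff
    have hi := (hg (hBc.toSchwartzMap hBs)).1
    refine (hi.integrableOn (s := K)).congr_fun (fun x hx => ?_) hK.measurableSet
    have hx1 : B x = 1 := B.one_of_mem_closedBall
      (Metric.closedBall_subset_closedBall (le_max_left _ _) (hR hx))
    simp [hx1]
  have h0 := ae_eq_zero_of_integral_contDiff_smul_eq_zero (μ := volume)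
    ((key hg).sub (key hh)) (fun b hb hbc => by
      have hBc : HasCompactSupport (Complex.ofRealCLM ∘ b) := hbc.comp_left rfl
      have hBs : ContDiff ℝ ∞ (Complex.ofRealCLM ∘ b) := Complex.ofRealCLM.contDiff.comp hb
      obtain ⟨i1, e1⟩ := hg (hBc.toSchwartzMap hBs)
      obtain ⟨i2, e2⟩ := hh (hBc.toSchwartzMap hBs)
      have := integral_sub i1 i2
      rw [← e1, ← e2, sub_self] at this
      rw [← this]
      refine integral_congr_ae (Filter.Eventually.of_forall fun x => ?_)
      simp [mul_sub])
  filter_upwards [h0] with x hx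
  simpa [sub_eq_zero] using hx

/-- The quasi-norm of a family of distributions is computed by any representing functions. -/
theorem distLpLqNorm_eq {d : ℕ} {ι : Type} [Countable ι] (p : ℝ) (q : ℝ≥0∞) (w : ι → ℝ≥0∞)
    {T : ι → 𝓢'(Rd d, ℂ)} {g : ι → Rd d → ℂ} (hg : ∀ k, IsGivenBy (T k) (g k)) :
    distLpLqNorm p q w T = LpLqNorm p q w g := by
  refine le_antisymm (iInf₂_le g hg) (le_iInf₂ fun h hh => le_of_eq ?_)
  unfold LpLqNorm
  congr 1
  refine lintegral_congr_ae ?_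
  filter_upwards [ae_all_iff.2 fun k => (hg k).ae_eq (hh k)] with x hx
  simp only [hx]

/-- The symbols `φ_j(2π ·)` are smooth of temperate growth, as Mathlib's Fourier multipliers
require. -/
theorem isoSymbol_hasTemperateGrowth {d : ℕ} (φ₀ : 𝓢(Rd d, ℝ)) (j : ℕ) :
    (fun ξ => isoSymbol φ₀ j ((2 * Real.pi) • ξ)).HasTemperateGrowth := by
  have h (c : ℝ) : (fun ξ : Rd d => (φ₀ (c • ξ) : ℂ)).HasTemperateGrowth := by
    have h1 := φ₀.hasTemperateGrowth
    have h2 : (fun ξ : Rd d => c • ξ).HasTemperateGrowth := by fun_prop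
    exact Complex.ofRealCLM.hasTemperateGrowth.comp (h1.comp h2)
  cases j with
  | zero => exact h _
  | succ j =>
    simp only [isoSymbol, dyadic, smul_smul]
    exact (h _).sub (h _)

/-- The same for the symbols `η_k(2π ·)`. -/
theorem mixSymbol_hasTemperateGrowth {d : ℕ} {η₀ : ℝ → ℂ} (h0 : IsUnivariateGenerator η₀)
    (k : Fin d → ℕ) :
    (fun ξ : Rd d => mixSymbol η₀ k ((2 * Real.pi) • ξ)).HasTemperateGrowth := by
  have hc : HasCompactSupport η₀ := isCompact_Icc.of_isClosed_subset (isClosed_tsupport _)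
    h0.tsupport_subset
  have h (c : ℝ) (i : Fin d) : (fun ξ : Rd d => η₀ (c * ξ i)).HasTemperateGrowth := by
    have h1 := (hc.toSchwartzMap h0.smooth).hasTemperateGrowth
    have h2 : (fun ξ : Rd d => c * ξ i).HasTemperateGrowth :=
      (c • (EuclideanSpace.proj i : Rd d →L[ℝ] ℝ)).hasTemperateGrowth
    exact h1.comp h2
  have hd (n : ℕ) (i : Fin d) :
      (fun ξ : Rd d => dyadic η₀ n (((2 * Real.pi) • ξ) i)).HasTemperateGrowth := by
    cases n with
    | zero => exact h _ i
    | succ n =>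
      simp only [dyadic, PiLp.smul_apply, smul_eq_mul, ← mul_assoc]
      exact (h _ i).sub (h _ i)
  have : ∀ s : Finset (Fin d), (fun ξ : Rd d =>
      ∏ i ∈ s, dyadic η₀ (k i) (((2 * Real.pi) • ξ) i)).HasTemperateGrowth := by
    intro s
    induction s using Finset.cons_induction with
    | empty => simp
    | cons a s ha ih =>
      simp only [Finset.prod_cons]
      exact (hd (k a) a).mul ih
  exact this Finset.univ

end MixedSmoothness

namespace MixedSmoothness

/-! ### Minkowski's integral inequality -/

/-! The embedding of the isotropic space enters only through three numerical consequences: `p ≤ p₀`,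
`t₀ - 1 / p₀ ≤ t - 1 / p`, and `q ≤ q₀` in the limiting case `p = p₀`, `t = t₀`. These conditions
already suffice for the embedding between the two spaces of dominating mixed smoothness.

Necessity (`necessary_conditions`) comes from test functions for which both quasi-norms are
explicit. Their spectrum lies where exactly one isotropic and exactly one mixed symbol are equal to
`1` and all others vanish. Along a suitable frequency direction (`exists_direction`) the `n`-th
isotropic piece meets a mixed piece with `|k|₁ = d n - e`, where `e` does not depend on `n`. So the
isotropic weight for smoothness `t d` equals the mixed weight for smoothness `t` up to a constant.
Shrinking bumps at the origin give the first condition, bumps of width `2 ^ n` at distance about `2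
^ n` the second, and sums of many unit bumps in different shells the third.

For sufficiency, the case `p = p₀` is elementary: monotonicity of `ℓ_q` if `t = t₀`, and a
convergent geometric series if `t₀ < t`. The case `p < p₀` is an embedding of Jawerth type, valid
for all `q`, `q₀`. It needs only one property of the pieces `g_k`: a power `|g_k| ^ r` is dominated,
in each variable separately, by its average at scale `2 ^ (-k_i)` (`exists_meanValueProperty`). In
one variable this gives `B m ≤ 2 ^ (m / s) * N`. Together with the trivial bound by the supremum it
makes the weighted sum over `m` a two-sided geometric series (`exists_tsum_rpow_mul_le`). The
variables are then treated one at a time, with Minkowski's integral inequality restoring the order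
of integration (`exists_lmarginal_partialSum_le`). -/

theorem lintegral_rpow_lintegral_le {α β : Type*} [MeasurableSpace α] [MeasurableSpace β]
    (μ : Measure α) (ν : Measure β) [SigmaFinite μ] [SFinite ν] {s : ℝ} (hs : 1 ≤ s)
    {f : α → β → ℝ≥0∞} (hf : Measurable (Function.uncurry f)) :
    (∫⁻ x, (∫⁻ y, f x y ∂ν) ^ s ∂μ) ^ (1 / s) ≤ ∫⁻ y, (∫⁻ x, f x y ^ s ∂μ) ^ (1 / s) ∂ν := by
  rcases hs.eq_or_lt with rfl | hs1
  · simpa using (lintegral_lintegral_swap hf.aemeasurable).le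
  have hs0 : 0 < s := by linarith
  set R := ∫⁻ y, (∫⁻ x, f x y ^ s ∂μ) ^ (1 / s) ∂ν with hR
  set Φ : α → ℝ≥0∞ := fun x => ∫⁻ y, f x y ∂ν with hΦ
  have hΦm : Measurable Φ := hf.lintegral_prod_right'
  -- Truncation in height and support makes `∫ Ψ ^ s` finite, so that it can be divided out of the
  -- Hölder estimate `J ≤ J ^ (1 - 1 / s) * R`. Monotone convergence then removes the truncation.
  let Ψ : ℕ → α → ℝ≥0∞ := fun n => (spanningSets μ n).indicator (fun x => min (Φ x) n)
  have hΨm : ∀ n, Measurable (Ψ n) := fun n =>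
    (hΦm.min measurable_const).indicator (measurableSet_spanningSets μ n)
  have hΨle : ∀ n x, Ψ n x ≤ Φ x := fun n x => by
    refine (Set.indicator_le_self' (fun _ _ => zero_le) x).trans (min_le_left _ _)
  have hJ : ∀ n, ∫⁻ x, Ψ n x ^ s ∂μ ≤ R ^ s := by
    intro n
    set J := ∫⁻ x, Ψ n x ^ s ∂μ with hJdef
    have hJfin : J ≠ ⊤ := by
      have h1 : J ≤ ∫⁻ x, (spanningSets μ n).indicator (fun _ => (n : ℝ≥0∞) ^ s) x ∂μ := by
        refine lintegral_mono fun x => ?_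
        by_cases hx : x ∈ spanningSets μ n
        · simp only [Ψ, Set.indicator_of_mem hx]
          exact ENNReal.rpow_le_rpow (min_le_right _ _) hs0.le
        · simp [Ψ, hx, hs0]
      refine ne_top_of_le_ne_top ?_ h1
      rw [lintegral_indicator_const (measurableSet_spanningSets μ n)]
      exact ENNReal.mul_ne_top (ENNReal.rpow_ne_top_of_nonneg hs0.le (by simp))
        (measure_spanningSets_lt_top μ n).ne
    have hconj : (s / (s - 1)).HolderConjugate s := by
      rw [Real.holderConjugate_comm]
      exact Real.HolderConjugate.conjExponent hs1
    have h2 : J ≤ J ^ (1 / (s / (s - 1))) * R := by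
      calc J ≤ ∫⁻ x, Ψ n x ^ (s - 1) * Φ x ∂μ := by
            refine lintegral_mono fun x => ?_
            calc Ψ n x ^ s = Ψ n x ^ ((s - 1) + 1) := by ring_nf
              _ = Ψ n x ^ (s - 1) * Ψ n x := by
                rw [ENNReal.rpow_add_of_nonneg _ _ (by linarith) zero_le_one, ENNReal.rpow_one]
              _ ≤ _ := by gcongr; exact hΨle n x
        _ = ∫⁻ x, ∫⁻ y, Ψ n x ^ (s - 1) * f x y ∂ν ∂μ := by
            refine lintegral_congr fun x => ?_
            exact (lintegral_const_mul _ (hf.comp measurable_prodMk_left)).symm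
        _ = ∫⁻ y, ∫⁻ x, Ψ n x ^ (s - 1) * f x y ∂μ ∂ν :=
            lintegral_lintegral_swap (((((hΨm n).pow_const _).comp measurable_fst).mul
              hf).aemeasurable)
        _ ≤ ∫⁻ y, J ^ (1 / (s / (s - 1))) * (∫⁻ x, f x y ^ s ∂μ) ^ (1 / s) ∂ν := by
            refine lintegral_mono fun y => ?_
            refine (ENNReal.lintegral_mul_le_Lp_mul_Lq μ hconj
              ((hΨm n).pow_const _).aemeasurable
              (hf.comp measurable_prodMk_right).aemeasurable).trans (le_of_eq ?_)
            have : ∀ x, (Ψ n x ^ (s - 1)) ^ (s / (s - 1)) = Ψ n x ^ s := fun x => by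
              rw [← ENNReal.rpow_mul]
              congr 1
              field_simp [sub_ne_zero.2 hs1.ne']
            simp only [this, hJdef, Function.comp_apply, Function.uncurry]
        _ = _ := by
            rw [lintegral_const_mul]
            exact (hf.pow_const s).lintegral_prod_left'.pow_const _
    have hexp : 1 / (s / (s - 1)) = 1 - 1 / s := by field_simp
    rw [hexp] at h2
    by_cases hJ0 : J = 0
    · rw [hJ0]; exact zero_le
    have h3 : J ^ (1 - 1 / s) * J ^ (1 / s) ≤ J ^ (1 - 1 / s) * R := by
      rw [← ENNReal.rpow_add _ _ hJ0 hJfin]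
      simpa using h2
    have h4 : J ^ (1 / s) ≤ R := by
      rwa [ENNReal.mul_le_mul_iff_right] at h3
      · exact (ENNReal.rpow_pos (pos_iff_ne_zero.2 hJ0) hJfin).ne'
      · refine ENNReal.rpow_ne_top_of_nonneg ?_ hJfin
        rw [sub_nonneg, div_le_one hs0]; exact hs
    calc J = (J ^ (1 / s)) ^ s := by rw [← ENNReal.rpow_mul]; simp [hs0.ne']
      _ ≤ R ^ s := ENNReal.rpow_le_rpow h4 hs0.le
  have hmono : Monotone fun n x => Ψ n x ^ s := by
    intro n m hnm x
    refine ENNReal.rpow_le_rpow ?_ hs0.le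
    by_cases hx : x ∈ spanningSets μ n
    · simp only [Ψ, Set.indicator_of_mem hx,
        Set.indicator_of_mem (monotone_spanningSets μ hnm hx)]
      gcongr
    · simp [Ψ, hx]
  have hsup : ∀ x, Φ x ^ s ≤ ⨆ n, Ψ n x ^ s := by
    intro x
    refine le_of_forall_lt fun c hc => ?_
    have hc' : c ^ (1 / s) < Φ x := by
      rw [one_div, ENNReal.rpow_inv_lt_iff hs0]
      exact hc
    obtain ⟨n, hn⟩ : ∃ n : ℕ, c ^ (1 / s) < n := ENNReal.exists_nat_gt hc'.ne_top
    have hx : x ∈ spanningSets μ (spanningSetsIndex μ x) := mem_spanningSetsIndex μ x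
    refine lt_of_lt_of_le ?_ (le_iSup _ (max n (spanningSetsIndex μ x)))
    have hx' : x ∈ spanningSets μ (max n (spanningSetsIndex μ x)) :=
      monotone_spanningSets μ (le_max_right _ _) hx
    simp only [Ψ, Set.indicator_of_mem hx']
    rw [← ENNReal.rpow_inv_lt_iff hs0, ← one_div]
    refine lt_min hc' (hn.trans_le ?_)
    exact_mod_cast le_max_left _ _
  have hfin : ∫⁻ x, Φ x ^ s ∂μ ≤ R ^ s := by
    refine (lintegral_mono hsup).trans ?_
    rw [lintegral_iSup (fun n => (hΨm n).pow_const s) hmono]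
    exact iSup_le hJ
  rw [one_div, ENNReal.rpow_inv_le_iff hs0]
  exact hfin

/-! ### A geometric sum -/

theorem tsum_int_rpow_natAbs_ne_top {ρ : ℝ≥0∞} (hρ : ρ < 1) :
    ∑' n : ℤ, ρ ^ n.natAbs ≠ ⊤ := by
  have h : ∑' n : ℕ, ρ ^ n ≠ ⊤ := by
    rw [ENNReal.tsum_geometric]
    exact ENNReal.inv_ne_top.2 (tsub_pos_of_lt hρ).ne'
  rw [tsum_of_nat_of_neg_add_one ENNReal.summable ENNReal.summable]
  refine ENNReal.add_ne_top.2 ⟨by simpa using h, ne_top_of_le_ne_top h ?_⟩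
  refine ENNReal.tsum_le_tsum fun n => ?_
  refine pow_le_pow_right_of_le_one' hρ.le ?_
  omega

/-- The bounds `F` and `2 ^ (m / s) * N` cross at one real value `x` of `m`. After weighting, the
second bound grows geometrically up to `x` and the first decays geometrically beyond it. Hence the
series is comparable to its value at the crossing, which is `F ^ θ * N ^ (1 - θ)` with `θ = s / s₀`.
-/
theorem exists_tsum_rpow_mul_le {s s₀ : ℝ} (hs : 0 < s) (hss : s < s₀) :
    ∃ C : ℝ≥0∞, C ≠ ⊤ ∧ ∀ (F N : ℝ≥0∞) (B : ℕ → ℝ≥0∞), (∀ m, B m ≤ F) →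
      (∀ m, B m ≤ 2 ^ ((m : ℝ) / s) * N) →
      ∑' m : ℕ, (2 : ℝ≥0∞) ^ (-((m : ℝ) * (1 / s - 1 / s₀))) * B m
        ≤ C * (F ^ (s / s₀) * N ^ (1 - s / s₀)) := by
  have hs0 : 0 < s₀ := hs.trans hss
  set θ := s / s₀ with hθ
  have hθ0 : 0 < θ := div_pos hs hs0
  have hθ1 : θ < 1 := (div_lt_one hs0).2 hss
  -- The slower of the two geometric rates, growth before the crossing and decay after it.
  set c := min (θ / s) ((1 - θ) / s) with hc
  have hc0 : 0 < c := lt_min (div_pos hθ0 hs) (div_pos (by linarith) hs)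
  set ρ : ℝ≥0∞ := 2 ^ (-c) with hρ
  have hρ1 : ρ < 1 := ENNReal.rpow_lt_one_of_one_lt_of_neg (by norm_num) (by linarith)
  set S := ∑' n : ℤ, ρ ^ n.natAbs with hS
  -- This factor pays for rounding the crossing point `x` down to the integer `J`. As `J` may be
  -- negative, `S` is a sum over all of `ℤ`.
  set D : ℝ≥0∞ := 2 ^ (1 / s) with hD
  have hDtop : D ≠ ⊤ := ENNReal.rpow_ne_top_of_nonneg (by positivity) (by norm_num)
  refine ⟨D * S, ENNReal.mul_ne_top hDtop (tsum_int_rpow_natAbs_ne_top hρ1), ?_⟩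
  intro F N B hBF hBN
  have hS1 : 1 ≤ S := by
    have := ENNReal.le_tsum (f := fun n : ℤ => ρ ^ n.natAbs) 0
    simpa using this
  have hD1 : 1 ≤ D := ENNReal.one_le_rpow (by norm_num) (by positivity)
  have hDS : D * S ≠ 0 := by
    have : 1 ≤ D * S := one_le_mul hD1 hS1
    exact (zero_lt_one.trans_le this).ne'
  by_cases hF0 : F = 0
  · have : ∀ m, B m = 0 := fun m => by simpa [hF0] using hBF m
    simp [this]
  by_cases hN0 : N = 0
  · have : ∀ m, B m = 0 := fun m => by simpa [hN0] using hBN m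
    simp [this]
  by_cases hFt : F = ⊤
  · rw [hFt, ENNReal.top_rpow_of_pos hθ0, ENNReal.top_mul, ENNReal.mul_top hDS]
    · exact le_top
    · simp [ENNReal.rpow_eq_zero_iff, hN0]; intro; linarith
  by_cases hNt : N = ⊤
  · rw [hNt, ENNReal.top_rpow_of_pos (by linarith : 0 < 1 - θ), ENNReal.mul_top,
      ENNReal.mul_top hDS]
    · exact le_top
    · simp [ENNReal.rpow_eq_zero_iff, hF0]; intro; linarith
  -- The solution of `F = 2 ^ (x / s) * N`, where the two bounds coincide.
  set x : ℝ := s * Real.logb 2 (F.toReal / N.toReal) with hx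
  have hFp : 0 < F.toReal := ENNReal.toReal_pos hF0 hFt
  have hNp : 0 < N.toReal := ENNReal.toReal_pos hN0 hNt
  have hFN : F = 2 ^ (x / s) * N := by
    have h1 : (2 : ℝ) ^ (x / s) = F.toReal / N.toReal := by
      rw [hx, mul_div_cancel_left₀ _ hs.ne', Real.rpow_logb (by norm_num) (by norm_num)
        (div_pos hFp hNp)]
    have h2 : (2 : ℝ≥0∞) ^ (x / s) = ENNReal.ofReal (F.toReal / N.toReal) := by
      rw [← h1, ← ENNReal.ofReal_rpow_of_pos (by norm_num)]; norm_num
    rw [h2, ENNReal.ofReal_div_of_pos hNp, ENNReal.ofReal_toReal hFt, ENNReal.ofReal_toReal hNt,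
      ENNReal.div_mul_cancel hN0 hNt]
  have h2ne : (2 : ℝ≥0∞) ≠ 0 := by norm_num
  have h2t : (2 : ℝ≥0∞) ≠ ⊤ := by norm_num
  have hprod : F ^ θ * N ^ (1 - θ) = 2 ^ (x / s * θ) * N := by
    rw [hFN, ENNReal.mul_rpow_of_nonneg _ _ hθ0.le, ← ENNReal.rpow_mul, mul_assoc,
      ← ENNReal.rpow_add _ _ hN0 hNt]
    simp
  have hβ : 1 / s - 1 / s₀ = (1 - θ) / s := by
    rw [hθ]; field_simp
  set J : ℤ := ⌊x⌋ with hJ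
  have hterm : ∀ m : ℕ, (2 : ℝ≥0∞) ^ (-((m : ℝ) * (1 / s - 1 / s₀))) * B m
      ≤ (D * (2 ^ (x / s * θ) * N)) * ρ ^ ((m : ℤ) - J).natAbs := by
    intro m
    have hρp : ρ ^ ((m : ℤ) - J).natAbs = 2 ^ (-c * |(m : ℝ) - J|) := by
      rw [hρ, ← ENNReal.rpow_natCast, ← ENNReal.rpow_mul]
      congr 2
      rw [Nat.cast_natAbs]
      push_cast
      rfl
    have key : ∃ e : ℝ, B m ≤ 2 ^ e * N ∧
        -((m : ℝ) * ((1 - θ) / s)) + e ≤ 1 / s + x / s * θ + -c * |(m : ℝ) - J| := by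
      have hJ1 : (J : ℝ) ≤ x := Int.floor_le x
      have hJ2 : x < J + 1 := Int.lt_floor_add_one x
      rcases le_or_gt (m : ℤ) J with h | h
      · refine ⟨m / s, hBN m, ?_⟩
        have h' : (m : ℝ) ≤ J := by exact_mod_cast h
        rw [abs_of_nonpos (by linarith)]
        have h5 : c * ((J : ℝ) - m) ≤ θ / s * (J - m) :=
          mul_le_mul_of_nonneg_right (min_le_left _ _) (by linarith)
        have h6 : θ / s * J ≤ θ / s * x := by gcongr
        have h7 : 0 < 1 / s := by positivity
        have : -((m : ℝ) * ((1 - θ) / s)) + m / s = θ / s * m := by field_simp; ring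
        rw [this]
        have h8 : x / s * θ = θ / s * x := by ring
        rw [h8]; linarith
      · refine ⟨x / s, (hBF m).trans hFN.le, ?_⟩
        have h' : (J : ℝ) + 1 ≤ m := by exact_mod_cast h
        rw [abs_of_nonneg (by linarith)]
        have h5 : c * ((m : ℝ) - J) ≤ (1 - θ) / s * (m - J) :=
          mul_le_mul_of_nonneg_right (min_le_right _ _) (by linarith)
        have h6 : (1 - θ) / s * x ≤ (1 - θ) / s * (J + 1) := by gcongr
        have h7 : (1 - θ) / s ≤ 1 / s := by gcongr; linarith
        have h8 : x / s = x / s * θ + (1 - θ) / s * x := by field_simp; ring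
        have h9 : (1 - θ) / s * (J + 1) = (1 - θ) / s * J + (1 - θ) / s := by ring
        have h10 : (1 - θ) / s * (m - J) = m * ((1 - θ) / s) - (1 - θ) / s * J := by ring
        linarith
    obtain ⟨e, he, hle⟩ := key
    rw [hβ, hρp, hD]
    calc (2 : ℝ≥0∞) ^ (-((m : ℝ) * ((1 - θ) / s))) * B m
        ≤ 2 ^ (-((m : ℝ) * ((1 - θ) / s))) * (2 ^ e * N) := by gcongr
      _ = 2 ^ (-((m : ℝ) * ((1 - θ) / s)) + e) * N := by
          rw [ENNReal.rpow_add _ _ h2ne h2t, mul_assoc]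
      _ ≤ 2 ^ (1 / s + x / s * θ + -c * |(m : ℝ) - J|) * N := by
          gcongr
          · norm_num
      _ = _ := by
          rw [ENNReal.rpow_add _ _ h2ne h2t, ENNReal.rpow_add _ _ h2ne h2t]
          ring
  calc _ ≤ ∑' m : ℕ, (D * (2 ^ (x / s * θ) * N)) * ρ ^ ((m : ℤ) - J).natAbs :=
        ENNReal.tsum_le_tsum hterm
    _ = (D * (2 ^ (x / s * θ) * N)) * ∑' m : ℕ, ρ ^ ((m : ℤ) - J).natAbs := ENNReal.tsum_mul_left
    _ ≤ (D * (2 ^ (x / s * θ) * N)) * S := by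
        gcongr
        exact ENNReal.tsum_comp_le_tsum_of_injective
          (f := fun m : ℕ => (m : ℤ) - J) (fun a b h => by simpa using h)
          (fun n : ℤ => ρ ^ n.natAbs)
    _ = D * S * (2 ^ (x / s * θ) * N) := by ring
    _ = _ := by rw [hprod]

/-! ### Averages with integrable weights -/

/-- The weight `2^k (1 + 2^k |y|)^{-2}` on the real line. -/
noncomputable def dyadicWeight (k : ℕ) (y : ℝ) : ℝ≥0∞ :=
  ENNReal.ofReal (2 ^ k * ((1 + 2 ^ k * |y|) ^ 2)⁻¹)

theorem measurable_dyadicWeight (k : ℕ) : Measurable (dyadicWeight k) := by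
  unfold dyadicWeight
  fun_prop

theorem dyadicWeight_le (k : ℕ) (y : ℝ) : dyadicWeight k y ≤ 2 ^ k := by
  have : (2 : ℝ≥0∞) ^ k = ENNReal.ofReal (2 ^ k) := by
    rw [ENNReal.ofReal_pow (by norm_num)]; norm_num
  rw [dyadicWeight, this]
  refine ENNReal.ofReal_le_ofReal ?_
  refine mul_le_of_le_one_right (by positivity) (inv_le_one_of_one_le₀ ?_)
  exact one_le_pow₀ (by have := abs_nonneg y; nlinarith [pow_pos (two_pos : (0 : ℝ) < 2) k])

theorem lintegral_dyadicWeight_le (k : ℕ) (x : ℝ) :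
    ∫⁻ y, dyadicWeight k (x - y) ≤ ∫⁻ y, dyadicWeight 0 y := by
  rw [lintegral_sub_left_eq_self (fun y => dyadicWeight k y) x]
  have h2 : (0 : ℝ) < 2 ^ k := by positivity
  have hsc : ∀ y, dyadicWeight k y = 2 ^ k * dyadicWeight 0 (2 ^ k * y) := by
    intro y
    have : (2 : ℝ≥0∞) ^ k = ENNReal.ofReal (2 ^ k) := by
      rw [ENNReal.ofReal_pow (by norm_num)]; norm_num
    rw [dyadicWeight, dyadicWeight, this, ← ENNReal.ofReal_mul h2.le]
    simp [abs_mul]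
  simp only [hsc]
  have hm : Measurable fun y : ℝ => dyadicWeight 0 (2 ^ k * y) :=
    (measurable_dyadicWeight 0).comp (measurable_const_mul _)
  rw [lintegral_const_mul _ hm, ← lintegral_map (measurable_dyadicWeight 0) (measurable_const_mul _),
    Real.map_volume_mul_left h2.ne', lintegral_smul_measure, smul_eq_mul, ← mul_assoc,
    abs_of_pos (inv_pos.2 h2), ENNReal.ofReal_inv_of_pos h2, ENNReal.ofReal_pow (by norm_num)]
  norm_num
  rw [ENNReal.mul_inv_cancel (by simp) (by simp), one_mul]

theorem lintegral_dyadicWeight_zero_ne_top : ∫⁻ y, dyadicWeight 0 y ≠ ⊤ := by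
  have h : Integrable fun y : ℝ => (1 + ‖y‖) ^ (-(2 : ℝ)) :=
    integrable_one_add_norm (by simp)
  have h2 := h.lintegral_lt_top.ne
  convert h2 using 4 with y
  simp [dyadicWeight, Real.rpow_neg (by positivity : 0 ≤ 1 + |y|)]

/-- A mean value inequality with an integrable weight implies a Nikol'skij type bound. -/
theorem exists_le_of_le_lintegral_dyadicWeight {s : ℝ} (hs : 1 ≤ s) {C₀ : ℝ≥0∞} (hC₀ : C₀ ≠ ⊤) :
    ∃ C : ℝ≥0∞, C ≠ ⊤ ∧ ∀ (k : ℕ) (x : ℝ) (F : ℝ → ℝ≥0∞) (a : ℝ≥0∞), Measurable F →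
      a ≤ C₀ * ∫⁻ y, F y * dyadicWeight k (x - y) →
      a ≤ 2 ^ ((k : ℝ) / s) * (C * (∫⁻ y, F y ^ s) ^ (1 / s)) := by
  have hs0 : 0 < s := by linarith
  set W := ∫⁻ y, dyadicWeight 0 y with hW
  have hWt : W ≠ ⊤ := lintegral_dyadicWeight_zero_ne_top
  refine ⟨C₀ * W ^ (1 - 1 / s), ENNReal.mul_ne_top hC₀ (ENNReal.rpow_ne_top_of_nonneg ?_ hWt), ?_⟩
  · rw [sub_nonneg, div_le_one hs0]; exact hs
  intro k x F a hF ha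
  refine ha.trans ?_
  have hwm : Measurable fun y => dyadicWeight k (x - y) :=
    (measurable_dyadicWeight k).comp (measurable_const.sub measurable_id)
  have key : ∫⁻ y, F y * dyadicWeight k (x - y)
      ≤ 2 ^ ((k : ℝ) / s) * (∫⁻ y, F y ^ s) ^ (1 / s) * W ^ (1 - 1 / s) := by
    have hpow : (2 : ℝ≥0∞) ^ ((k : ℝ) / s) = ((2 : ℝ≥0∞) ^ k) ^ (1 / s) := by
      rw [← ENNReal.rpow_natCast, ← ENNReal.rpow_mul, mul_one_div]
    have h1 : ∫⁻ y, F y ^ s * dyadicWeight k (x - y) ≤ 2 ^ k * ∫⁻ y, F y ^ s := by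
      rw [← lintegral_const_mul _ (hF.pow_const s)]
      refine lintegral_mono fun y => ?_
      rw [mul_comm]
      gcongr
      exact dyadicWeight_le _ _
    rcases hs.eq_or_lt with rfl | hs1
    · simpa using h1
    have hconj : s.HolderConjugate (s / (s - 1)) := Real.HolderConjugate.conjExponent hs1
    have hexp : 1 / (s / (s - 1)) = 1 - 1 / s := by field_simp
    -- Splitting the weight as `w ^ (1 / s) * w ^ (1 - 1 / s)` lets Hölder use both of its
    -- properties: the pointwise bound `2 ^ k` on the first factor, and a mass bounded uniformly in
    -- `k` on the second.
    calc ∫⁻ y, F y * dyadicWeight k (x - y)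
        = ∫⁻ y, (F y * dyadicWeight k (x - y) ^ (1 / s)) *
            dyadicWeight k (x - y) ^ (1 - 1 / s) := by
          refine lintegral_congr fun y => ?_
          rw [mul_assoc, ← ENNReal.rpow_add_of_nonneg _ _ (by positivity)]
          · simp
          · rw [sub_nonneg, div_le_one hs0]; exact hs
      _ ≤ _ := ENNReal.lintegral_mul_le_Lp_mul_Lq _ hconj
            (hF.mul (hwm.pow_const _)).aemeasurable (hwm.pow_const _).aemeasurable
      _ = (∫⁻ y, F y ^ s * dyadicWeight k (x - y)) ^ (1 / s) *
            (∫⁻ y, dyadicWeight k (x - y)) ^ (1 - 1 / s) := by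
          rw [hexp]
          congr 3
          · ext y
            rw [ENNReal.mul_rpow_of_nonneg _ _ hs0.le, ← ENNReal.rpow_mul]
            simp [hs0.ne']
          · ext y
            rw [← ENNReal.rpow_mul]
            have : (1 - 1 / s) * (s / (s - 1)) = 1 := by
              field_simp [sub_ne_zero.2 hs1.ne']
            rw [this, ENNReal.rpow_one]
      _ ≤ (2 ^ k * ∫⁻ y, F y ^ s) ^ (1 / s) * W ^ (1 - 1 / s) := by
          refine mul_le_mul' (ENNReal.rpow_le_rpow h1 (by positivity))
            (ENNReal.rpow_le_rpow (lintegral_dyadicWeight_le k x) ?_)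
          rw [sub_nonneg, div_le_one hs0]; exact hs
      _ = _ := by rw [ENNReal.mul_rpow_of_nonneg _ _ (by positivity), hpow]
  calc _ ≤ C₀ * (2 ^ ((k : ℝ) / s) * (∫⁻ y, F y ^ s) ^ (1 / s) * W ^ (1 - 1 / s)) := by gcongr
    _ = _ := by ring

/-! ### The embedding of Jawerth type for families with a mean value property -/

/-- The measure on `ℕ` with mass `2^{-mβ}` at `m`. -/
noncomputable def dyadicMeasure (β : ℝ) : Measure ℕ :=
  Measure.sum fun m : ℕ => (2 : ℝ≥0∞) ^ (-((m : ℝ) * β)) • Measure.dirac m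

theorem lintegral_dyadicMeasure (β : ℝ) (f : ℕ → ℝ≥0∞) :
    ∫⁻ m, f m ∂dyadicMeasure β = ∑' m : ℕ, (2 : ℝ≥0∞) ^ (-((m : ℝ) * β)) * f m := by
  simp [dyadicMeasure, lintegral_sum_measure, lintegral_smul_measure]

theorem dyadicMeasure_singleton (β : ℝ) (m : ℕ) :
    dyadicMeasure β {m} = (2 : ℝ≥0∞) ^ (-((m : ℝ) * β)) := by
  rw [← lintegral_indicator_one (measurableSet_singleton m), lintegral_dyadicMeasure,
    tsum_eq_single m]
  · simp
  · intro n hn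
    simp [hn]

theorem prod_dyadicMeasure_singleton {ι : Type*} (β : ℝ) (k : ι → ℕ) (J : Finset ι) :
    ∏ i ∈ J, dyadicMeasure β {k i} = (2 : ℝ≥0∞) ^ (-(((∑ i ∈ J, k i : ℕ) : ℝ) * β)) := by
  induction J using Finset.cons_induction with
  | empty => simp
  | cons a J ha ih =>
    rw [Finset.prod_cons, ih, Finset.sum_cons, dyadicMeasure_singleton,
      ← ENNReal.rpow_add _ _ (by simp) (by simp)]
    congr 1
    push_cast
    ring

instance (β : ℝ) : SigmaFinite (dyadicMeasure β) := by
  refine ⟨⟨⟨fun n => {n}, fun _ => trivial, fun n => ?_, Set.iUnion_of_singleton ℕ⟩⟩⟩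
  rw [dyadicMeasure_singleton]
  exact (ENNReal.rpow_ne_top_of_ne_zero (by norm_num) (by norm_num)).lt_top

section Jawerth

variable {ι : Type}

theorem measurable_index [Finite ι] (f : (ι → ℕ) → ℝ≥0∞) : Measurable f :=
  measurable_of_countable f

variable [DecidableEq ι]

/-- The family `A` has the mean value property in each variable. -/
def HasMeanValueProperty (C₀ : ℝ≥0∞) (A : (ι → ℕ) → (ι → ℝ) → ℝ≥0∞) : Prop :=
  ∀ k i x, A k x ≤ C₀ * ∫⁻ y, A k (Function.update x i y) * dyadicWeight (k i) (x i - y)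

/-- The supremum over `k` of the weighted sums of `A` over the indices `k_i`, `i ∈ I`. -/
noncomputable def partialSum (β : ℝ) (A : (ι → ℕ) → (ι → ℝ) → ℝ≥0∞) (I : Finset ι)
    (x : ι → ℝ) : ℝ≥0∞ :=
  ⨆ k, lmarginal (fun _ => dyadicMeasure β) I (fun k => A k x) k

theorem measurable_lmarginal_index [Finite ι] {β : ℝ} {A : (ι → ℕ) → (ι → ℝ) → ℝ≥0∞}
    (hA : ∀ k, Measurable (A k)) (I : Finset ι) (k : ι → ℕ) :
    Measurable fun x => lmarginal (fun _ => dyadicMeasure β) I (fun k => A k x) k := by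
  unfold lmarginal
  refine Measurable.lintegral_prod_right' (f := fun z : (ι → ℝ) × (∀ _ : I, ℕ) =>
    A (Function.updateFinset k I z.2) z.1) ?_
  exact measurable_from_prod_countable_left fun y => hA (Function.updateFinset k I y)

theorem measurable_partialSum [Finite ι] {β : ℝ} {A : (ι → ℕ) → (ι → ℝ) → ℝ≥0∞}
    (hA : ∀ k, Measurable (A k)) (I : Finset ι) : Measurable (partialSum β A I) :=
  Measurable.iSup fun k => measurable_lmarginal_index hA I k

/-- With `k_i = m` fixed, the sum over the indices in `I` is at most the partial sum `H` for `I`. It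
also inherits the mean value inequality in `x_i`, hence is at most `2 ^ (m / s)` times the `L_s`
norm of `H` along the line. These are the two bounds needed in `exists_tsum_rpow_mul_le`. -/
theorem exists_partialSum_insert_le [Finite ι] {s s₀ : ℝ} (hs : 1 ≤ s) (hss : s < s₀)
    {C₀ : ℝ≥0∞} (hC₀ : C₀ ≠ ⊤) :
    ∃ C : ℝ≥0∞, C ≠ ⊤ ∧ ∀ A : (ι → ℕ) → (ι → ℝ) → ℝ≥0∞, (∀ k, Measurable (A k)) →
      HasMeanValueProperty C₀ A → ∀ (I : Finset ι) (i : ι), i ∉ I → ∀ x,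
        partialSum (1 / s - 1 / s₀) A (insert i I) x ≤
          C * (partialSum (1 / s - 1 / s₀) A I x ^ (s / s₀) *
            ((∫⁻ y, partialSum (1 / s - 1 / s₀) A I (Function.update x i y) ^ s) ^ (1 / s))
              ^ (1 - s / s₀)) := by
  have hs0 : 0 < s := by linarith
  have hθ1 : s / s₀ < 1 := (div_lt_one (hs0.trans hss)).2 hss
  obtain ⟨C₁, hC₁, h₁⟩ := exists_tsum_rpow_mul_le hs0 hss
  obtain ⟨C₂, hC₂, h₂⟩ := exists_le_of_le_lintegral_dyadicWeight hs hC₀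
  refine ⟨C₁ * C₂ ^ (1 - s / s₀),
    ENNReal.mul_ne_top hC₁ (ENNReal.rpow_ne_top_of_nonneg (by linarith) hC₂), ?_⟩
  intro A hA hmv I i hi x
  set β := 1 / s - 1 / s₀ with hβ
  set H := partialSum β A I with hH
  have hHm : Measurable H := measurable_partialSum hA I
  refine iSup_le fun k => ?_
  rw [lmarginal_insert _ (measurable_index _) hi, lintegral_dyadicMeasure]
  refine (h₁ (H x) (C₂ * (∫⁻ y, H (Function.update x i y) ^ s) ^ (1 / s)) _ ?_ ?_).trans ?_
  · intro m
    exact le_iSup (fun k => lmarginal (fun _ => dyadicMeasure β) I (fun k => A k x) k) _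
  · intro m
    refine h₂ m (x i) (fun y => H (Function.update x i y)) _
      (hHm.comp (measurable_update x)) ?_
    set k' := Function.update k i m with hk'
    -- Since `i ∉ I`, summation over `I` does not touch `k_i`. All terms therefore have the same
    -- averaging weight, and it can be taken out of the sum.
    have hup : ∀ y : ∀ _ : I, ℕ, Function.updateFinset k' I y i = m := fun y => by
      simp [Function.updateFinset, hi, hk']
    calc lmarginal (fun _ => dyadicMeasure β) I (fun k => A k x) k'
        ≤ ∫⁻ y : (∀ _ : I, ℕ), C₀ * (∫⁻ z, A (Function.updateFinset k' I y)
            (Function.update x i z) * dyadicWeight m (x i - z))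
            ∂Measure.pi (fun _ : I => dyadicMeasure β) := by
          refine lintegral_mono fun y => ?_
          have := hmv (Function.updateFinset k' I y) i x
          rwa [hup] at this
      _ = C₀ * ∫⁻ z, (∫⁻ y : (∀ _ : I, ℕ), A (Function.updateFinset k' I y)
            (Function.update x i z) ∂Measure.pi (fun _ : I => dyadicMeasure β)) *
              dyadicWeight m (x i - z) := by
          have hw : Measurable fun z => dyadicWeight m (x i - z) :=
            (measurable_dyadicWeight m).comp (measurable_const.sub measurable_id)
          have hjm : Measurable fun z : (∀ _ : I, ℕ) × ℝ =>
              A (Function.updateFinset k' I z.1) (Function.update x i z.2) *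
                dyadicWeight m (x i - z.2) :=
            measurable_from_prod_countable_right fun y =>
              ((hA (Function.updateFinset k' I y)).comp (measurable_update x)).mul hw
          rw [lintegral_const_mul _ (measurable_of_countable _),
            lintegral_lintegral_swap hjm.aemeasurable]
          congr 1
          refine lintegral_congr fun z => ?_
          rw [lintegral_mul_const _ (measurable_of_countable _)]
      _ ≤ C₀ * ∫⁻ z, H (Function.update x i z) * dyadicWeight m (x i - z) := by
          gcongr with z
          exact le_iSup (fun k => lmarginal (fun _ => dyadicMeasure β) I
            (fun k => A k (Function.update x i z)) k) k'
  · rw [ENNReal.mul_rpow_of_nonneg C₂ _ (by linarith : 0 ≤ 1 - s / s₀)]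
    exact le_of_eq (by ring)

/-- This is the one-variable Jawerth embedding. The `s₀`-th power of the preceding pointwise bound
is `H ^ s * N ^ ((s₀ - s) / s)` up to a constant, where `N` is constant along the line. Integrating
along the line adds one more factor `N`. -/
theorem exists_lintegral_partialSum_insert_le [Finite ι] {s s₀ : ℝ} (hs : 1 ≤ s) (hss : s < s₀)
    {C₀ : ℝ≥0∞} (hC₀ : C₀ ≠ ⊤) :
    ∃ C : ℝ≥0∞, C ≠ ⊤ ∧ ∀ A : (ι → ℕ) → (ι → ℝ) → ℝ≥0∞, (∀ k, Measurable (A k)) →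
      HasMeanValueProperty C₀ A → ∀ (I : Finset ι) (i : ι), i ∉ I → ∀ x,
        ∫⁻ y, partialSum (1 / s - 1 / s₀) A (insert i I) (Function.update x i y) ^ s₀ ≤
          C * (∫⁻ y, partialSum (1 / s - 1 / s₀) A I (Function.update x i y) ^ s) ^ (s₀ / s) := by
  have hs0 : 0 < s := by linarith
  have hs₀ : 0 < s₀ := hs0.trans hss
  obtain ⟨C, hC, h⟩ := exists_partialSum_insert_le (ι := ι) hs hss hC₀
  refine ⟨C ^ s₀, ENNReal.rpow_ne_top_of_nonneg hs₀.le hC, ?_⟩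
  intro A hA hmv I i hi x
  have hHm := measurable_partialSum (β := 1 / s - 1 / s₀) hA I
  set H := partialSum (1 / s - 1 / s₀) A I with hH
  set N := ∫⁻ y, H (Function.update x i y) ^ s with hN
  calc _ ≤ ∫⁻ y, C ^ s₀ * (H (Function.update x i y) ^ s * N ^ ((s₀ - s) / s)) := by
        refine lintegral_mono fun y => ?_
        refine (ENNReal.rpow_le_rpow (h A hA hmv I i hi (Function.update x i y)) hs₀.le).trans
          (le_of_eq ?_)
        simp only [Function.update_idem]
        rw [ENNReal.mul_rpow_of_nonneg _ _ hs₀.le, ENNReal.mul_rpow_of_nonneg _ _ hs₀.le,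
          ← ENNReal.rpow_mul, ← ENNReal.rpow_mul, ← ENNReal.rpow_mul]
        congr 3
        · field_simp
        · field_simp
    _ = C ^ s₀ * (N * N ^ ((s₀ - s) / s)) := by
        have hm : Measurable fun y => H (Function.update x i y) ^ s :=
          (hHm.comp (measurable_update x)).pow_const s
        rw [lintegral_const_mul _ (hm.mul_const _), lintegral_mul_const _ hm]
    _ = _ := by
        congr 1
        nth_rw 1 [← ENNReal.rpow_one N]
        rw [← ENNReal.rpow_add_of_nonneg _ _ zero_le_one
          (div_nonneg (by linarith) hs0.le)]
        congr 1
        field_simp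
        ring

/-- Minkowski's inequality for marginals. -/
theorem lmarginal_rpow_lintegral_update_le [Finite ι] {τ : ℝ} (hτ : 1 ≤ τ)
    {f : (ι → ℝ) → ℝ≥0∞} (hf : Measurable f) {I : Finset ι} {i : ι} (hi : i ∉ I) (x : ι → ℝ) :
    (lmarginal (fun _ => (volume : Measure ℝ)) I
      (fun z => (∫⁻ y, f (Function.update z i y)) ^ τ) x) ^ (1 / τ) ≤
    ∫⁻ y, (lmarginal (fun _ => (volume : Measure ℝ)) I (fun z => f z ^ τ)
      (Function.update x i y)) ^ (1 / τ) := by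
  have hup : ∀ (y : ℝ) (z : ∀ _ : I, ℝ), Function.updateFinset (Function.update x i y) I z =
      Function.update (Function.updateFinset x I z) i y := by
    intro y z
    ext j
    by_cases hj : j = i
    · subst hj; simp [Function.updateFinset, hi]
    · by_cases hjI : j ∈ I <;> simp [Function.updateFinset, hj, hjI]
  unfold lmarginal
  simp only [hup]
  refine lintegral_rpow_lintegral_le _ _ hτ
    (f := fun (z : ∀ _ : I, ℝ) y => f (Function.update (Function.updateFinset x I z) i y)) ?_
  refine hf.comp ?_
  refine measurable_pi_iff.2 fun j => ?_
  by_cases hj : j = i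
  · subst hj; simpa using measurable_snd
  · by_cases hjI : j ∈ I
    · simp only [Function.updateFinset, hj, hjI, ne_eq, not_false_eq_true, Function.update_of_ne,
        dite_true]
      exact (measurable_pi_apply _).comp measurable_fst
    · simp [Function.updateFinset, hj, hjI]

/-- The induction hypothesis carries a mixed norm: `L_{s₀}` inside in the variables already treated,
`L_s` outside in the others. When `i` joins `I`, the one-variable embedding replaces the `L_{s₀}`
norm in `x_i` by an `L_s` norm. This leaves an integral in `x_i` inside an `L_{s₀/s}` norm over the
variables in `I`. As `s₀ / s ≥ 1`, Minkowski's inequality moves this integral outside, which is the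
form of the hypothesis for `I`. -/
theorem exists_lmarginal_partialSum_le [Fintype ι] {s s₀ : ℝ} (hs : 1 ≤ s) (hss : s < s₀)
    {C₀ : ℝ≥0∞} (hC₀ : C₀ ≠ ⊤) (I : Finset ι) :
    ∃ C : ℝ≥0∞, C ≠ ⊤ ∧ ∀ A : (ι → ℕ) → (ι → ℝ) → ℝ≥0∞, (∀ k, Measurable (A k)) →
      HasMeanValueProperty C₀ A → ∀ x₀,
        lmarginal (fun _ => (volume : Measure ℝ)) Iᶜ
          (fun x => (lmarginal (fun _ => (volume : Measure ℝ)) I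
            (fun x => partialSum (1 / s - 1 / s₀) A I x ^ s₀) x) ^ (s / s₀)) x₀ ≤
          C * ∫⁻ x, (⨆ k, A k x) ^ s := by
  have hs0 : 0 < s := by linarith
  have hs₀ : 0 < s₀ := hs0.trans hss
  induction I using Finset.induction_on with
  | empty =>
    refine ⟨1, by simp, fun A hA hmv x₀ => ?_⟩
    simp only [Finset.compl_empty, lmarginal_univ, lmarginal_empty, one_mul, partialSum]
    refine lintegral_mono fun x => ?_
    rw [← ENNReal.rpow_mul, mul_div_cancel₀ _ hs₀.ne']
  | insert i I hi ih =>
    obtain ⟨C₁, hC₁, h₁⟩ := ih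
    obtain ⟨C₂, hC₂, h₂⟩ := exists_lintegral_partialSum_insert_le (ι := ι) hs hss hC₀
    refine ⟨C₂ ^ (s / s₀) * C₁,
      ENNReal.mul_ne_top (ENNReal.rpow_ne_top_of_nonneg (by positivity) hC₂) hC₁, ?_⟩
    intro A hA hmv x₀
    set β := 1 / s - 1 / s₀ with hβ
    have hHm : ∀ J, Measurable (partialSum β A J) := measurable_partialSum hA
    have hJ : Iᶜ = insert i (insert i I)ᶜ := by
      ext j; by_cases hj : j = i
      · subst hj; simp [hi]
      · simp [hj]
    have hiJ : i ∉ (insert i I)ᶜ := by simp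
    have hτ : 1 ≤ s₀ / s := (one_le_div hs0).2 hss.le
    refine le_trans ?_ ((mul_le_mul_right (h₁ A hA hmv x₀) (C₂ ^ (s / s₀))).trans_eq
      (mul_assoc _ _ _).symm)
    have hm1 : Measurable fun x => (lmarginal (fun _ => (volume : Measure ℝ)) I
        (fun x => partialSum β A I x ^ s₀) x) ^ (s / s₀) :=
      (((hHm I).pow_const s₀).lmarginal _).pow_const _
    rw [hJ, lmarginal_insert' _ hm1 hiJ]
    have hm2 : Measurable fun x : ι → ℝ => ∫⁻ y, (lmarginal (fun _ => (volume : Measure ℝ)) I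
        (fun x => partialSum β A I x ^ s₀) (Function.update x i y)) ^ (s / s₀) := by
      exact (hm1.comp measurable_update').lintegral_prod_right'
    have : C₂ ^ (s / s₀) * lmarginal (fun _ => (volume : Measure ℝ)) (insert i I)ᶜ
        (fun x => ∫⁻ y, (lmarginal (fun _ => (volume : Measure ℝ)) I
          (fun x => partialSum β A I x ^ s₀) (Function.update x i y)) ^ (s / s₀)) x₀ =
        lmarginal (fun _ => (volume : Measure ℝ)) (insert i I)ᶜ
        (fun x => C₂ ^ (s / s₀) * ∫⁻ y, (lmarginal (fun _ => (volume : Measure ℝ)) I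
          (fun x => partialSum β A I x ^ s₀) (Function.update x i y)) ^ (s / s₀)) x₀ := by
      unfold lmarginal
      rw [lintegral_const_mul]
      exact hm2.comp measurable_updateFinset
    rw [this]
    refine lmarginal_mono (fun x => ?_) x₀
    have hm3 : Measurable fun x => partialSum β A (insert i I) x ^ s₀ := (hHm _).pow_const _
    simp only
    rw [lmarginal_insert' _ hm3 hi]
    have hsd : s / s₀ = 1 / (s₀ / s) := by field_simp
    calc _ ≤ (lmarginal (fun _ => (volume : Measure ℝ)) I (fun z => C₂ *
            (∫⁻ y, partialSum β A I (Function.update z i y) ^ s) ^ (s₀ / s)) x) ^ (s / s₀) := by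
          refine ENNReal.rpow_le_rpow ?_ (by positivity)
          exact lmarginal_mono (fun z => h₂ A hA hmv I i hi z) x
      _ = (C₂ * lmarginal (fun _ => (volume : Measure ℝ)) I (fun z =>
            (∫⁻ y, partialSum β A I (Function.update z i y) ^ s) ^ (s₀ / s)) x) ^ (s / s₀) := by
          congr 1
          unfold lmarginal
          rw [lintegral_const_mul]
          have hm4 : Measurable fun z : ι → ℝ => ∫⁻ y, partialSum β A I (Function.update z i y) ^ s :=
            (((hHm I).pow_const s).comp measurable_update').lintegral_prod_right'
          exact (hm4.pow_const _).comp measurable_updateFinset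
      _ = C₂ ^ (s / s₀) * (lmarginal (fun _ => (volume : Measure ℝ)) I (fun z =>
            (∫⁻ y, partialSum β A I (Function.update z i y) ^ s) ^ (s₀ / s)) x) ^ (s / s₀) := by
          rw [ENNReal.mul_rpow_of_nonneg _ _ (by positivity)]
      _ ≤ _ := by
          gcongr
          rw [hsd]
          refine (lmarginal_rpow_lintegral_update_le hτ ((hHm I).pow_const s) hi x).trans_eq ?_
          refine lintegral_congr fun y => ?_
          congr 3
          ext z
          rw [← ENNReal.rpow_mul, mul_div_cancel₀ _ hs0.ne']

/-- The embedding of Jawerth type for families of functions with the mean value property. -/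
theorem exists_lintegral_tsum_le [Fintype ι] {s s₀ : ℝ} (hs : 1 ≤ s) (hss : s < s₀)
    {C₀ : ℝ≥0∞} (hC₀ : C₀ ≠ ⊤) :
    ∃ C : ℝ≥0∞, C ≠ ⊤ ∧ ∀ A : (ι → ℕ) → (ι → ℝ) → ℝ≥0∞, (∀ k, Measurable (A k)) →
      HasMeanValueProperty C₀ A →
        (∫⁻ x, (∑' k, (2 : ℝ≥0∞) ^ (-(((∑ i, k i : ℕ) : ℝ) * (1 / s - 1 / s₀))) * A k x) ^ s₀)
          ^ (1 / s₀) ≤ C * (∫⁻ x, (⨆ k, A k x) ^ s) ^ (1 / s) := by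
  have hs0 : 0 < s := by linarith
  have hs₀ : 0 < s₀ := hs0.trans hss
  obtain ⟨C, hC, h⟩ := exists_lmarginal_partialSum_le (ι := ι) hs hss hC₀ Finset.univ
  refine ⟨C ^ (1 / s), ENNReal.rpow_ne_top_of_nonneg (by positivity) hC, ?_⟩
  intro A hA hmv
  have h1 := h A hA hmv 0
  simp only [Finset.compl_univ, lmarginal_empty, lmarginal_univ] at h1
  -- Once every index is summed, nothing depends on the base index, so the supremum in `partialSum`
  -- is taken over a constant.
  have hsum : ∀ x, ∑' k, (2 : ℝ≥0∞) ^ (-(((∑ i, k i : ℕ) : ℝ) * (1 / s - 1 / s₀))) * A k x =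
      partialSum (1 / s - 1 / s₀) A Finset.univ x := by
    intro x
    simp only [partialSum, lmarginal_univ, ciSup_const]
    rw [lintegral_countable']
    refine tsum_congr fun k => ?_
    rw [Measure.pi_singleton, mul_comm]
    congr 1
    exact (prod_dyadicMeasure_singleton _ k Finset.univ).symm
  simp only [hsum]
  have h2 := ENNReal.rpow_le_rpow h1 (by positivity : 0 ≤ 1 / s)
  rw [ENNReal.mul_rpow_of_nonneg _ _ (by positivity : 0 ≤ 1 / s), ← ENNReal.rpow_mul] at h2
  have : s / s₀ * (1 / s) = 1 / s₀ := by field_simp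
  rwa [this] at h2

end Jawerth

section MeanValue

open scoped FourierTransform
open Filter Topology

/-! ### Band-limited functions of one variable -/

/-- The function `(1 + 2^k |y|)^{-1}` with values in `[0, ∞]`. -/
noncomputable def decayWeight (k : ℕ) (y : ℝ) : ℝ≥0∞ :=
  ENNReal.ofReal ((1 + 2 ^ k * |y|)⁻¹)

theorem decayWeight_le_one (k : ℕ) (y : ℝ) : decayWeight k y ≤ 1 := by
  rw [decayWeight, ENNReal.ofReal_le_one]
  exact inv_le_one_of_one_le₀ (by have := abs_nonneg y; have : (0:ℝ) < 2 ^ k := by positivity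
                                  nlinarith)

theorem dyadicWeight_eq (k : ℕ) (y : ℝ) : dyadicWeight k y = 2 ^ k * decayWeight k y ^ 2 := by
  rw [decayWeight, dyadicWeight, ENNReal.ofReal_mul (by positivity),
    ENNReal.ofReal_pow (by norm_num), ← inv_pow, ENNReal.ofReal_pow (by positivity)]
  norm_num

/-- Peetre's inequality: by the triangle inequality, `(1 + a) * (1 + b) ≥ 1 + a + b` for `a, b ≥ 0`.
-/
theorem decayWeight_mul_le (k : ℕ) (x y z : ℝ) :
    decayWeight k (y - z) * decayWeight k (x - y) ≤ decayWeight k (x - z) := by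
  rw [decayWeight, decayWeight, decayWeight, ← ENNReal.ofReal_mul (by positivity), ← mul_inv]
  refine ENNReal.ofReal_le_ofReal (inv_anti₀ (by positivity) ?_)
  have h1 : |x - z| ≤ |x - y| + |y - z| := abs_sub_le x y z
  have h2 : (0 : ℝ) < 2 ^ k := by positivity
  have h3 := mul_le_mul_of_nonneg_left h1 h2.le
  have h4 : 0 ≤ (2 ^ k * |y - z|) * (2 ^ k * |x - y|) := by positivity
  nlinarith

/-- A bounded function reproduced by convolution with a rapidly decreasing kernel satisfies a mean
value inequality with any exponent `r ∈ (0, 1]`. -/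
theorem rpow_enorm_le_of_eq_convolution {r : ℝ} (hr : 0 < r) (hr1 : r ≤ 1) {N : ℕ}
    (hN : 2 ≤ N * r) (k : ℕ) {D : ℝ≥0∞} {K ℓ : ℝ → ℂ} {B : ℝ≥0∞} (hB : B ≠ ⊤)
    (hK : ∀ y, ‖K y‖ₑ ≤ D * (2 ^ k * decayWeight k y ^ N))
    (hℓB : ∀ x, ‖ℓ x‖ₑ ≤ B) (hℓm : Measurable ℓ)
    (hℓ : ∀ x, ℓ x = ∫ y, K y * ℓ (x - y)) (x : ℝ) :
    ‖ℓ x‖ₑ ^ r ≤ D * ∫⁻ y, ‖ℓ y‖ₑ ^ r * dyadicWeight k (x - y) := by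
  set I := ∫⁻ y, ‖ℓ y‖ₑ ^ r * dyadicWeight k (x - y) with hI
  -- A Peetre maximal function at `x`. It dominates `‖ℓ x‖ₑ`, and the a priori bound `B` serves only
  -- to make it finite, so that `M ^ (1 - r)` can be cancelled.
  set M : ℝ≥0∞ := ⨆ y, decayWeight k (x - y) ^ N * ‖ℓ y‖ₑ with hM
  have hMB : M ≤ B := iSup_le fun y =>
    (mul_le_of_le_one_left' (pow_le_one' (decayWeight_le_one k _) N)).trans (hℓB y)
  have hMt : M ≠ ⊤ := ne_top_of_le_ne_top hB hMB
  have hxM : ‖ℓ x‖ₑ ≤ M := by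
    refine le_trans ?_ (le_iSup _ x)
    simp [decayWeight]
  -- In the reproducing integral the weighted value of `ℓ` is split into powers `1 - r` and `r`. The
  -- first is absorbed by the supremum; the second keeps the weight `v ^ (N * r) ≤ v ^ 2`, which is
  -- integrable.
  have hmain : M ≤ D * (M ^ (1 - r) * I) := by
    refine iSup_le fun y => ?_
    have h1 : ‖ℓ y‖ₑ ≤ ∫⁻ z, D * (2 ^ k * decayWeight k (y - z) ^ N) * ‖ℓ z‖ₑ := by
      rw [hℓ y]
      refine (enorm_integral_le_lintegral_enorm _).trans ?_
      rw [← lintegral_sub_left_eq_self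
        (fun z => D * (2 ^ k * decayWeight k (y - z) ^ N) * ‖ℓ z‖ₑ) y]
      refine lintegral_mono fun z => ?_
      rw [enorm_mul, sub_sub_cancel]
      gcongr
      exact hK z
    have hwm : Measurable fun z => decayWeight k (x - z) := by
      unfold decayWeight; fun_prop
    have hdm : Measurable fun z => dyadicWeight k (x - z) :=
      (measurable_dyadicWeight k).comp (measurable_const.sub measurable_id)
    calc decayWeight k (x - y) ^ N * ‖ℓ y‖ₑ
        ≤ decayWeight k (x - y) ^ N *
            ∫⁻ z, D * (2 ^ k * decayWeight k (y - z) ^ N) * ‖ℓ z‖ₑ := by gcongr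
      _ = ∫⁻ z, decayWeight k (x - y) ^ N *
            (D * (2 ^ k * decayWeight k (y - z) ^ N) * ‖ℓ z‖ₑ) := by
          rw [lintegral_const_mul']
          exact ENNReal.pow_ne_top (ne_top_of_le_ne_top ENNReal.one_ne_top (decayWeight_le_one k _))
      _ ≤ ∫⁻ z, D * (M ^ (1 - r) * (‖ℓ z‖ₑ ^ r * dyadicWeight k (x - z))) := by
          refine lintegral_mono fun z => ?_
          set v := decayWeight k (x - z) with hv
          have hv1 : v ≤ 1 := decayWeight_le_one k _
          have e1 : decayWeight k (x - y) ^ N * decayWeight k (y - z) ^ N ≤ v ^ N := by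
            rw [← mul_pow, mul_comm]
            exact pow_le_pow_left' (decayWeight_mul_le k x y z) N
          have e2 : v ^ N * ‖ℓ z‖ₑ ≤ M ^ (1 - r) * (‖ℓ z‖ₑ ^ r * v ^ 2) := by
            calc v ^ N * ‖ℓ z‖ₑ = (v ^ N * ‖ℓ z‖ₑ) ^ ((1 - r) + r) := by simp
              _ = (v ^ N * ‖ℓ z‖ₑ) ^ (1 - r) * (v ^ N * ‖ℓ z‖ₑ) ^ r :=
                ENNReal.rpow_add_of_nonneg _ _ (by linarith) hr.le
              _ ≤ M ^ (1 - r) * (‖ℓ z‖ₑ ^ r * v ^ 2) := by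
                refine mul_le_mul' (ENNReal.rpow_le_rpow
                  (le_iSup (fun y => decayWeight k (x - y) ^ N * ‖ℓ y‖ₑ) z) (by linarith)) ?_
                rw [ENNReal.mul_rpow_of_nonneg _ _ hr.le, mul_comm]
                gcongr
                rw [← ENNReal.rpow_natCast, ← ENNReal.rpow_natCast, ← ENNReal.rpow_mul]
                exact ENNReal.rpow_le_rpow_of_exponent_ge hv1 (by exact_mod_cast hN)
          calc _ = D * (2 ^ k * ((decayWeight k (x - y) ^ N * decayWeight k (y - z) ^ N)
                  * ‖ℓ z‖ₑ)) := by ring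
            _ ≤ D * (2 ^ k * (M ^ (1 - r) * (‖ℓ z‖ₑ ^ r * v ^ 2))) := by
                exact mul_le_mul_right (mul_le_mul_right ((mul_le_mul_left e1 _).trans e2) _) _
            _ = _ := by rw [dyadicWeight_eq]; ring
      _ = D * (M ^ (1 - r) * I) := by
          have hm1 : Measurable fun z => ‖ℓ z‖ₑ ^ r * dyadicWeight k (x - z) :=
            (hℓm.enorm.pow_const r).mul hdm
          rw [lintegral_const_mul _ (hm1.const_mul _), lintegral_const_mul _ hm1]
  by_cases hM0 : M = 0
  · have : ‖ℓ x‖ₑ = 0 := by simpa [hM0] using hxM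
    rw [this, ENNReal.zero_rpow_of_pos hr]
    exact zero_le
  refine (ENNReal.rpow_le_rpow hxM hr.le).trans ?_
  have h2 : M ^ (1 - r) * M ^ r ≤ M ^ (1 - r) * (D * I) := by
    rw [← ENNReal.rpow_add _ _ hM0 hMt]
    calc M ^ (1 - r + r) = M := by simp
      _ ≤ _ := hmain
      _ = _ := by ring
  rwa [ENNReal.mul_le_mul_iff_right] at h2
  · exact (ENNReal.rpow_pos (pos_iff_ne_zero.2 hM0) hMt).ne'
  · exact ENNReal.rpow_ne_top_of_nonneg (by linarith) hMt

/-- The dilated kernel `2^k κ(2^k y)`. -/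
noncomputable def dilate (κ : 𝓢(ℝ, ℂ)) (k : ℕ) (y : ℝ) : ℂ := (2 : ℂ) ^ k * κ (2 ^ k * y)

theorem exists_enorm_dilate_le (κ : 𝓢(ℝ, ℂ)) (N : ℕ) :
    ∃ D : ℝ≥0∞, D ≠ ⊤ ∧ ∀ k y, ‖dilate κ k y‖ₑ ≤ D * (2 ^ k * decayWeight k y ^ N) := by
  set C := 2 ^ N * (Finset.Iic (N, 0)).sup (fun m => SchwartzMap.seminorm ℝ m.1 m.2) κ with hC
  refine ⟨ENNReal.ofReal C, ENNReal.ofReal_ne_top, fun k y => ?_⟩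
  have h := SchwartzMap.one_add_le_sup_seminorm_apply (𝕜 := ℝ) (m := (N, 0)) (k := N) (n := 0)
    le_rfl le_rfl κ (2 ^ k * y)
  rw [norm_iteratedFDeriv_zero] at h
  have hp : (0 : ℝ) < (1 + 2 ^ k * |y|) ^ N := by positivity
  have h2 : ‖κ (2 ^ k * y)‖ ≤ C * ((1 + 2 ^ k * |y|)⁻¹) ^ N := by
    rw [inv_pow, ← div_eq_mul_inv, le_div_iff₀ hp, mul_comm]
    simpa [abs_mul] using h
  have hC0 : 0 ≤ C := by
    have := (norm_nonneg _).trans h2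
    exact nonneg_of_mul_nonneg_left this (by positivity)
  have e2 : (2 : ℝ≥0∞) ^ k = ENNReal.ofReal (2 ^ k) := by
    rw [ENNReal.ofReal_pow (by norm_num)]; norm_num
  rw [decayWeight, e2, ← ENNReal.ofReal_pow (by positivity), ← ENNReal.ofReal_mul (by positivity),
    ← ENNReal.ofReal_mul hC0, ← ofReal_norm]
  refine ENNReal.ofReal_le_ofReal ?_
  simp only [dilate, norm_mul, norm_pow, Complex.norm_ofNat]
  calc (2 : ℝ) ^ k * ‖κ (2 ^ k * y)‖ ≤ 2 ^ k * (C * ((1 + 2 ^ k * |y|)⁻¹) ^ N) := by gcongr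
    _ = _ := by ring

theorem integrable_dilate (κ : 𝓢(ℝ, ℂ)) (k : ℕ) : Integrable (dilate κ k) :=
  (κ.integrable.comp_mul_left' (by positivity : (2 : ℝ) ^ k ≠ 0)).const_mul _

theorem integral_dilate (κ : 𝓢(ℝ, ℂ)) (k : ℕ) (σ : ℝ) :
    ∫ y, (Real.fourierChar (-(y * σ)) : ℂ) * dilate κ k y = 𝓕 κ (σ / 2 ^ k) := by
  have h2 : (0 : ℝ) < 2 ^ k := by positivity
  rw [SchwartzMap.fourier_coe, Real.fourier_real_eq]
  have := Measure.integral_comp_mul_left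
    (fun t : ℝ => Real.fourierChar (-(t * (σ / 2 ^ k))) • κ t) ((2 : ℝ) ^ k)
  rw [abs_of_pos (inv_pos.2 h2), eq_comm, inv_smul_eq_iff₀ h2.ne'] at this
  rw [this, ← integral_smul]
  refine integral_congr_ae (Eventually.of_forall fun y => ?_)
  have e : 2 ^ k * y * (σ / 2 ^ k) = y * σ := by field_simp
  simp only [dilate, e, Circle.smul_def, smul_eq_mul, Complex.real_smul]
  push_cast
  ring

/-! ### Reproducing kernels -/

variable {d : ℕ}

/-- By Fubini, averaging `𝓕 Λ` with `K` along the `i`-th axis multiplies `Λ` by `m (ξ i)`, which is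
harmless wherever `Λ ≠ 0`. -/
theorem fourier_eq_integral_add_single {Λ : 𝓢(Rd d, ℂ)} {K m : ℝ → ℂ} (hK : Integrable K)
    (hm : ∀ σ, ∫ y, (Real.fourierChar (-(y * σ)) : ℂ) * K y = m σ) (i : Fin d)
    (hΛ : ∀ ξ, m (ξ i) * Λ ξ = Λ ξ) (z : Rd d) :
    𝓕 Λ z = ∫ y, K y * 𝓕 Λ (z + EuclideanSpace.single i y) := by
  have hint : Integrable (Function.uncurry fun (y : ℝ) (ξ : Rd d) =>
      K y * ((Real.fourierChar (-inner ℝ ξ (z + EuclideanSpace.single i y)) : ℂ) * Λ ξ))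
      (volume.prod volume) := by
    have h1 := hK.mul_prod (Λ.integrable (μ := volume))
    refine (h1.bdd_mul (c := 1) (f := fun p : ℝ × Rd d =>
      (Real.fourierChar (-inner ℝ p.2 (z + EuclideanSpace.single i p.1)) : ℂ)) ?_ ?_).congr ?_
    · refine Continuous.aestronglyMeasurable ?_
      have : Continuous fun y : ℝ => (EuclideanSpace.single i y : Rd d) := by
        have : (fun y : ℝ => (EuclideanSpace.single i y : Rd d)) =
            fun y => y • EuclideanSpace.single i (1 : ℝ) := by ext y; simp
        rw [this]; fun_prop
      fun_prop
    · exact Eventually.of_forall fun p => (Circle.norm_coe _).le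
    · exact Eventually.of_forall fun p => by simp only [Function.uncurry]; ring
  have key : ∀ y, K y * 𝓕 Λ (z + EuclideanSpace.single i y) =
      ∫ ξ, K y * ((Real.fourierChar (-inner ℝ ξ (z + EuclideanSpace.single i y)) : ℂ) * Λ ξ) := by
    intro y
    rw [integral_const_mul, SchwartzMap.fourier_coe, Real.fourier_eq]
    simp [Circle.smul_def]
  simp_rw [key]
  rw [integral_integral_swap hint, SchwartzMap.fourier_coe, Real.fourier_eq]
  refine integral_congr_ae (Eventually.of_forall fun ξ => ?_)
  simp only [Circle.smul_def, smul_eq_mul]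
  have : ∀ y : ℝ, K y * ((Real.fourierChar (-inner ℝ ξ (z + EuclideanSpace.single i y)) : ℂ) * Λ ξ)
      = ((Real.fourierChar (-inner ℝ ξ z) : ℂ) * Λ ξ) *
        ((Real.fourierChar (-(y * ξ i)) : ℂ) * K y) := by
    intro y
    have e : -inner ℝ ξ (z + EuclideanSpace.single i y) = -inner ℝ ξ z + -(y * ξ i) := by
      rw [inner_add_right, neg_add]
      simp [EuclideanSpace.inner_single_right]
    rw [e, AddChar.map_add_eq_mul, Circle.coe_mul]
    ring
  simp_rw [this]
  rw [integral_const_mul, hm, mul_assoc, mul_comm (Λ ξ), hΛ]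

/-! ### Frequency localization -/

/-- The Fourier transform of a normalized bump function around `0`. -/
noncomputable def fourierBump (b : ContDiffBump (0 : Rd d)) : 𝓢(Rd d, ℂ) :=
  𝓕 ((b.hasCompactSupport_normed.comp_left (g := Complex.ofReal) rfl).toSchwartzMap
    (Complex.ofRealCLM.contDiff.comp (b.contDiff_normed (μ := volume))))

theorem fourierBump_apply (b : ContDiffBump (0 : Rd d)) (x : Rd d) :
    fourierBump b x = ∫ η, b.normed volume η • (Real.fourierChar (-inner ℝ η x) : ℂ) := by
  rw [fourierBump, SchwartzMap.fourier_coe, Real.fourier_eq]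
  refine integral_congr_ae (Eventually.of_forall fun η => ?_)
  simp only [Circle.smul_def, smul_eq_mul, Complex.real_smul, mul_comm]
  rfl

theorem norm_fourierBump_le (b : ContDiffBump (0 : Rd d)) (x : Rd d) : ‖fourierBump b x‖ ≤ 1 := by
  rw [fourierBump_apply]
  refine (norm_integral_le_integral_norm _).trans (le_of_eq ?_)
  rw [← b.integral_normed (μ := volume)]
  refine integral_congr_ae (Eventually.of_forall fun η => ?_)
  simp only [norm_smul, Circle.norm_coe, Real.norm_eq_abs, abs_of_nonneg (b.nonneg_normed η),
    mul_one]

/-- The normalized bumps form an approximate identity, tested here against the character `η ↦ e(η ·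
x)`, whose value at `0` is `1`. -/
theorem tendsto_fourierBump {b : ℕ → ContDiffBump (0 : Rd d)}
    (hb : Tendsto (fun n => (b n).rOut) atTop (𝓝 0)) (x : Rd d) :
    Tendsto (fun n => fourierBump (b n) x) atTop (𝓝 1) := by
  have hc : Continuous fun η : Rd d => (Real.fourierChar (inner ℝ η x) : ℂ) := by fun_prop
  have h := ContDiffBump.convolution_tendsto_right_of_continuous (φ := b) (l := atTop)
    (μ := volume) hb hc 0
  simp only [convolution_def, zero_sub, inner_neg_left, inner_zero_left] at h
  simp only [fourierBump_apply]
  simpa using h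

/-- Multiplication by `fourierBump b` is convolution with the bump on the frequency side, so it
spreads the spectrum by at most `b.rOut`. -/
theorem fourierInv_fourierBump_mul_eq_zero (b : ContDiffBump (0 : Rd d)) (v : 𝓢(Rd d, ℂ))
    (ξ : Rd d) (hξ : ∀ η, ‖η‖ ≤ b.rOut → 𝓕⁻ v (ξ - η) = 0) :
    𝓕⁻ (SchwartzMap.smulLeftCLM ℂ (fourierBump b) v) ξ = 0 := by
  set β := (b.hasCompactSupport_normed.comp_left (g := Complex.ofReal) rfl).toSchwartzMap
    (Complex.ofRealCLM.contDiff.comp (b.contDiff_normed (μ := volume))) with hβ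
  have e : SchwartzMap.smulLeftCLM ℂ (fourierBump b) v =
      𝓕 (SchwartzMap.convolution (ContinuousLinearMap.mul ℂ ℂ) β (𝓕⁻ v)) := by
    rw [SchwartzMap.fourier_convolution]
    ext x
    rw [SchwartzMap.smulLeftCLM_apply_apply (fourierBump b).hasTemperateGrowth]
    simp [fourierBump, hβ]
  rw [e, FourierTransform.fourierInv_fourier_eq, SchwartzMap.convolution_apply, convolution_def]
  refine integral_eq_zero_of_ae (Eventually.of_forall fun η => ?_)
  by_cases hη : ‖η‖ ≤ b.rOut
  · simp [hξ η hη]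
  · have : b.normed volume η = 0 := by
      have h1 : η ∉ Function.support (b.normed volume) := by
        rw [b.support_normed_eq]
        simpa using (not_le.1 hη).le
      simpa using h1
    have h2 : β η = ((b.normed volume η : ℝ) : ℂ) := rfl
    simp [h2, this]

theorem fourierInv_convolution_apply (f g : 𝓢(Rd d, ℂ)) (ξ : Rd d) :
    𝓕⁻ (SchwartzMap.convolution (ContinuousLinearMap.mul ℂ ℂ) f g) ξ = 𝓕⁻ f ξ * 𝓕⁻ g ξ := by
  simp only [SchwartzMap.fourierInv_coe, Real.fourierInv_eq_fourier_neg]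
  simp only [← SchwartzMap.fourier_coe]
  rw [SchwartzMap.fourier_convolution]
  simp

end MeanValue

/-! ### The mean value property of the pieces of a distribution -/

section MeanValueProperty

open scoped FourierTransform
open Filter Topology

variable {d : ℕ} {η₀ : ℝ → ℂ}

theorem IsUnivariateGenerator.eq_zero (h0 : IsUnivariateGenerator η₀) {s : ℝ} (hs : 3 / 2 < |s|) :
    η₀ s = 0 := by
  by_contra h
  have := h0.tsupport_subset (subset_tsupport _ h)
  rw [Set.mem_Icc, ← abs_le] at this
  linarith

theorem IsUnivariateGenerator.apply_eq_one (h0 : IsUnivariateGenerator η₀) {s : ℝ}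
    (hs : |s| ≤ 1) : η₀ s = 1 := h0.eq_one s (abs_le.1 hs)

theorem IsUnivariateGenerator.abs_le_of_dyadic_ne_zero (h0 : IsUnivariateGenerator η₀) {j : ℕ}
    {s : ℝ} (hs : dyadic η₀ j s ≠ 0) : |s| ≤ 3 / 2 * 2 ^ j := by
  by_contra! h
  refine hs ?_
  cases j with
  | zero => exact h0.eq_zero (by simpa using h)
  | succ j =>
    have h1 : (0 : ℝ) < 2 ^ j := by positivity
    have h2 : (0 : ℝ) < 2 ^ (j + 1) := by positivity
    have e : ((2 : ℝ) ^ (j + 1)) = 2 * 2 ^ j := by ring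
    simp only [dyadic, smul_eq_mul]
    rw [h0.eq_zero, h0.eq_zero, sub_zero]
    · rw [abs_mul, abs_of_pos (inv_pos.2 h1), lt_inv_mul_iff₀ h1]
      nlinarith
    · rw [abs_mul, abs_of_pos (inv_pos.2 h2), lt_inv_mul_iff₀ h2]
      nlinarith

/-- The function `η₀(2πs/4)` as a Schwartz function. -/
noncomputable def univariateLowpass (h0 : IsUnivariateGenerator η₀) : 𝓢(ℝ, ℂ) :=
  HasCompactSupport.toSchwartzMap (f := fun s => η₀ (2 * Real.pi * s / 4))
    (HasCompactSupport.intro (isCompact_Icc (a := -1) (b := 1)) fun s hs => h0.eq_zero (by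
      rw [Set.mem_Icc, ← abs_le, not_le] at hs
      have := Real.pi_gt_three
      rw [abs_div, abs_mul, abs_of_pos (by positivity : 0 < 2 * Real.pi), abs_of_pos (four_pos : (0 : ℝ) < 4)]
      rw [lt_div_iff₀ four_pos]
      nlinarith))
    (h0.smooth.comp (by fun_prop))

/-- The function `∏ η₀(2π ξ_i 2^{-k_i} / 2)` as a Schwartz function. -/
noncomputable def lowpass (h0 : IsUnivariateGenerator η₀) (k : Fin d → ℕ) : 𝓢(Rd d, ℂ) :=
  HasCompactSupport.toSchwartzMap
    (f := fun ξ : Rd d => ∏ i, η₀ (2 * Real.pi * ξ i / 2 ^ k i / 2))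
    (HasCompactSupport.intro (((isCompact_univ_pi fun i : Fin d =>
      isCompact_Icc (a := -(2 : ℝ) ^ k i) (b := 2 ^ k i)).image
        (PiLp.continuous_toLp 2 (fun _ : Fin d => ℝ)))) fun ξ hξ => by
      have : ∃ i, ¬ (|ξ i| ≤ 2 ^ k i) := by
        by_contra! h
        exact hξ ⟨ξ.ofLp, fun i _ => abs_le.1 (h i), rfl⟩
      obtain ⟨i, hi⟩ := this
      refine Finset.prod_eq_zero (Finset.mem_univ i) (h0.eq_zero ?_)
      have := Real.pi_gt_three
      have h2 : (0 : ℝ) < 2 ^ k i := by positivity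
      rw [abs_div, abs_div, abs_mul, abs_of_pos (by positivity : 0 < 2 * Real.pi),
        abs_of_pos (two_pos : (0 : ℝ) < 2), abs_of_pos h2, lt_div_iff₀ two_pos, lt_div_iff₀ h2]
      nlinarith)
    (contDiff_prod fun i _ => h0.smooth.comp (by fun_prop))

theorem lowpass_apply (h0 : IsUnivariateGenerator η₀) (k : Fin d → ℕ) (ξ : Rd d) :
    lowpass h0 k ξ = ∏ i, η₀ (2 * Real.pi * ξ i / 2 ^ k i / 2) := rfl

/-- The cutoffs are nested. In the variable `2π ξ_i / 2 ^ k_i`, `lowpass` vanishes beyond `3`, while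
`univariateLowpass` is `1` up to `4`. -/
theorem univariateLowpass_mul_lowpass (h0 : IsUnivariateGenerator η₀) (k : Fin d → ℕ) (i : Fin d)
    (ξ : Rd d) : univariateLowpass h0 (ξ i / 2 ^ k i) * lowpass h0 k ξ = lowpass h0 k ξ := by
  by_cases h : |2 * Real.pi * ξ i / 2 ^ k i / 2| ≤ 3 / 2
  · have : univariateLowpass h0 (ξ i / 2 ^ k i) = 1 := by
      refine h0.apply_eq_one (s := 2 * Real.pi * (ξ i / 2 ^ k i) / 4) ?_
      have e : 2 * Real.pi * (ξ i / 2 ^ k i) / 4 = 2 * Real.pi * ξ i / 2 ^ k i / 2 / 2 := by ring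
      rw [e, abs_div, abs_of_pos (two_pos : (0 : ℝ) < 2)]
      linarith
    rw [this, one_mul]
  · have : lowpass h0 k ξ = 0 :=
      Finset.prod_eq_zero (Finset.mem_univ i) (h0.eq_zero (not_le.1 h))
    simp [this]

/-- Where the mixed symbol is nonzero, `|2π ξ_i| ≤ 3/2 * 2 ^ k_i`. A shift by `η` costs at most
`1/2`, which stays within the region `|2π ξ_i| ≤ 2 * 2 ^ k_i` where the factors of `lowpass` equal
`1`. -/
theorem lowpass_sub_eq_one (h0 : IsUnivariateGenerator η₀) (k : Fin d → ℕ) {ξ η : Rd d}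
    (hξ : mixSymbol η₀ k ((2 * Real.pi) • ξ) ≠ 0) (hη : ‖η‖ ≤ 1 / 20) :
    lowpass h0 k (ξ - η) = 1 := by
  rw [lowpass_apply]
  refine Finset.prod_eq_one fun i _ => h0.apply_eq_one ?_
  have h1 := h0.abs_le_of_dyadic_ne_zero (Finset.prod_ne_zero_iff.1 hξ i (Finset.mem_univ i))
  have h2 : |η i| ≤ 1 / 20 := (PiLp.norm_apply_le η i).trans hη
  have h3 : (1 : ℝ) ≤ 2 ^ k i := one_le_pow₀ one_le_two
  have h4 := Real.pi_lt_d2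
  have h5 := Real.pi_pos
  have e : 2 * Real.pi * (ξ - η) i = ((2 * Real.pi) • ξ) i - 2 * Real.pi * η i := by
    simp; ring
  have h6 : |2 * Real.pi * η i| ≤ 1 / 2 := by
    rw [abs_mul, abs_of_pos (by positivity : 0 < 2 * Real.pi)]
    nlinarith [abs_nonneg (η i)]
  rw [abs_div, abs_div, abs_of_pos (two_pos : (0 : ℝ) < 2),
    abs_of_pos (by positivity : (0 : ℝ) < 2 ^ k i), div_le_one two_pos,
    div_le_iff₀ (by positivity), e]
  have := abs_sub (((2 * Real.pi) • ξ) i) (2 * Real.pi * η i)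
  linarith

/-- The convolution of `h` with the kernel belonging to the symbol `Λ`. -/
noncomputable def smoothing (Λ : 𝓢(Rd d, ℂ)) (h : Rd d → ℂ) (x : Rd d) : ℂ :=
  ∫ z, 𝓕 Λ (z - x) * h z

theorem exists_norm_schwartzMap_le {V : Type*} [NormedAddCommGroup V] [NormedSpace ℝ V]
    (f : 𝓢(V, ℂ)) : ∃ C, ∀ x, ‖f x‖ ≤ C :=
  ⟨_, fun x => SchwartzMap.norm_le_seminorm ℝ f x⟩

theorem norm_smoothing_le {Λ : 𝓢(Rd d, ℂ)} {h : Rd d → ℂ} (hh : Integrable h) :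
    ∃ B, ∀ x, ‖smoothing Λ h x‖ ≤ B := by
  obtain ⟨C, hC⟩ := exists_norm_schwartzMap_le (𝓕 Λ)
  refine ⟨∫ z, C * ‖h z‖, fun x => ?_⟩
  refine norm_integral_le_of_norm_le (hh.norm.const_mul C) (Eventually.of_forall fun z => ?_)
  rw [norm_mul]
  gcongr
  exact hC _

theorem continuous_smoothing {Λ : 𝓢(Rd d, ℂ)} {h : Rd d → ℂ} (hh : Integrable h) :
    Continuous (smoothing Λ h) := by
  obtain ⟨C, hC⟩ := exists_norm_schwartzMap_le (𝓕 Λ)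
  refine continuous_of_dominated (bound := fun z => C * ‖h z‖) (fun x => ?_) (fun x => ?_)
    (hh.norm.const_mul C) (Eventually.of_forall fun z => ?_)
  · exact ((𝓕 Λ).continuous.comp (by fun_prop)).aestronglyMeasurable.mul hh.1
  · refine Eventually.of_forall fun z => ?_
    rw [norm_mul]
    gcongr
    exact hC _
  · exact ((𝓕 Λ).continuous.comp (by fun_prop)).mul continuous_const

theorem continuous_single (i : Fin d) :
    Continuous fun y : ℝ => (EuclideanSpace.single i y : Rd d) := by
  have : (fun y : ℝ => (EuclideanSpace.single i y : Rd d)) =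
      fun y => y • EuclideanSpace.single i (1 : ℝ) := by ext y; simp
  rw [this]
  fun_prop

theorem smoothing_eq_integral_sub_single {Λ : 𝓢(Rd d, ℂ)} {K m : ℝ → ℂ} (hK : Integrable K)
    (hm : ∀ σ, ∫ y, (Real.fourierChar (-(y * σ)) : ℂ) * K y = m σ) (i : Fin d)
    (hΛ : ∀ ξ, m (ξ i) * Λ ξ = Λ ξ) {h : Rd d → ℂ} (hh : Integrable h) (x : Rd d) :
    smoothing Λ h x = ∫ y, K y * smoothing Λ h (x - EuclideanSpace.single i y) := by
  obtain ⟨C, hC⟩ := exists_norm_schwartzMap_le (𝓕 Λ)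
  have hint : Integrable (Function.uncurry fun (y : ℝ) (z : Rd d) =>
      K y * (𝓕 Λ (z - (x - EuclideanSpace.single i y)) * h z)) (volume.prod volume) := by
    refine ((hK.mul_prod hh).bdd_mul (c := C) (f := fun p : ℝ × Rd d =>
      𝓕 Λ (p.2 - (x - EuclideanSpace.single i p.1))) ?_ ?_).congr ?_
    · have := continuous_single i
      exact ((𝓕 Λ).continuous.comp (by fun_prop)).aestronglyMeasurable
    · exact Eventually.of_forall fun p => hC _
    · exact Eventually.of_forall fun p => by simp only [Function.uncurry]; ring
  simp only [smoothing, ← integral_const_mul]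
  rw [integral_integral_swap hint]
  refine integral_congr_ae (Eventually.of_forall fun z => ?_)
  simp only
  rw [fourier_eq_integral_add_single hK hm i hΛ (z - x), ← integral_mul_const]
  refine integral_congr_ae (Eventually.of_forall fun y => ?_)
  simp only [sub_sub_eq_add_sub, add_sub_right_comm, mul_assoc]

/-- A localized piece of a distribution coincides with its smoothing. -/
theorem ae_eq_smoothing (h0 : IsUnivariateGenerator η₀) {k : Fin d → ℕ} {f : 𝓢'(Rd d, ℂ)}
    {g : Rd d → ℂ} (hg : IsGivenBy (multiplier (mixSymbol η₀ k) f) g)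
    (b : ContDiffBump (0 : Rd d)) (hb : b.rOut ≤ 1 / 20) :
    (fun x => fourierBump b x * g x) =ᵐ[volume]
      smoothing (lowpass h0 k) fun x => fourierBump b x * g x := by
  set T := multiplier (mixSymbol η₀ k) f with hT
  set θ := fourierBump b with hθ
  set Λ := lowpass h0 k with hΛ
  have hh : Integrable fun x => θ x * g x := (hg θ).1
  set h := fun x => θ x * g x with hhdef
  obtain ⟨C, hC⟩ := exists_norm_schwartzMap_le (𝓕 Λ)
  have hgrowth := mixSymbol_hasTemperateGrowth h0 k
  have h1 : IsGivenBy (TemperedDistribution.smulLeftCLM ℂ θ T) h := by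
    intro u
    obtain ⟨hi, he⟩ := hg (SchwartzMap.smulLeftCLM ℂ θ u)
    rw [TemperedDistribution.smulLeftCLM_apply_apply, he]
    have e : ∀ x, SchwartzMap.smulLeftCLM ℂ θ u x * g x = u x * h x := fun x => by
      rw [SchwartzMap.smulLeftCLM_apply_apply θ.hasTemperateGrowth]
      simp [hhdef]; ring
    simp only [e] at hi ⊢
    exact ⟨hi, trivial⟩
  refine h1.ae_eq fun u => ⟨?_, ?_⟩
  · obtain ⟨B, hB⟩ := norm_smoothing_le (Λ := Λ) hh
    exact u.integrable.mul_bdd (c := B) (continuous_smoothing hh).aestronglyMeasurable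
      (Eventually.of_forall hB)
  · set w := SchwartzMap.convolution (ContinuousLinearMap.mul ℂ ℂ) u (𝓕 Λ) with hw
    -- The inverse transform of `u - w` is `(1 - Λ) 𝓕⁻ u`, which vanishes within distance `b.rOut`
    -- of every point where the symbol is nonzero. Multiplication by `θ` cannot spread it onto such
    -- a point.
    have hzero : TemperedDistribution.smulLeftCLM ℂ θ T (u - w) = 0 := by
      rw [TemperedDistribution.smulLeftCLM_apply_apply, hT, multiplier,
        TemperedDistribution.fourierMultiplierCLM_apply_apply]
      have : SchwartzMap.smulLeftCLM ℂ (fun ξ => mixSymbol η₀ k ((2 * Real.pi) • ξ))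
          (𝓕⁻ (SchwartzMap.smulLeftCLM ℂ θ (u - w))) = 0 := by
        ext ξ
        rw [SchwartzMap.smulLeftCLM_apply_apply hgrowth]
        by_cases hξ : mixSymbol η₀ k ((2 * Real.pi) • ξ) = 0
        · simp [hξ]
        rw [fourierInv_fourierBump_mul_eq_zero]
        · simp
        · intro η hη
          have e1 : 𝓕⁻ (u - w) (ξ - η) = 𝓕⁻ u (ξ - η) - 𝓕⁻ w (ξ - η) := by
            exact congr_arg (fun F : 𝓢(Rd d, ℂ) => F (ξ - η))
              ((FourierTransform.fourierInvCLM ℂ 𝓢(Rd d, ℂ)).map_sub u w)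
          rw [e1, hw, fourierInv_convolution_apply, FourierTransform.fourierInv_fourier_eq,
            lowpass_sub_eq_one h0 k hξ (hη.trans hb)]
          simp
      rw [this]
      simp [FourierTransform.fourier_zero]
    have hint : Integrable (Function.uncurry fun (z x : Rd d) =>
        (u x * 𝓕 Λ (z - x)) * h z) (volume.prod volume) := by
      refine ((hh.mul_prod u.integrable).bdd_mul (c := C) (f := fun p : Rd d × Rd d =>
        𝓕 Λ (p.1 - p.2)) ?_ ?_).congr ?_
      · exact ((𝓕 Λ).continuous.comp (by fun_prop)).aestronglyMeasurable
      · exact Eventually.of_forall fun p => hC _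
      · exact Eventually.of_forall fun p => by simp only [Function.uncurry]; ring
    rw [map_sub, sub_eq_zero] at hzero
    rw [hzero, (h1 w).2]
    simp only [hw, SchwartzMap.convolution_apply, convolution_def, ContinuousLinearMap.mul_apply',
      ← integral_mul_const, smoothing, ← integral_const_mul]
    rw [integral_integral_swap hint]
    simp only [mul_assoc]

/-- The function `g` is neither known to be bounded nor defined on individual lines. Multiplying it
by `θ n`, the transform of a small bump, gives an integrable function that agrees almost everywhere
with a bounded continuous `H n`, still band-limited in each variable. The convolution inequality
applies to `H n` on every line. All `H n` have the form `θ n * G` with one `G`, the desired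
representative, and the inequality passes to the limit since `θ n → 1`. -/
theorem exists_meanValueProperty (h0 : IsUnivariateGenerator η₀) {r : ℝ} (hr : 0 < r)
    (hr1 : r ≤ 1) :
    ∃ C : ℝ≥0∞, C ≠ ⊤ ∧ ∀ (k : Fin d → ℕ) (f : 𝓢'(Rd d, ℂ)) (g : Rd d → ℂ),
      IsGivenBy (multiplier (mixSymbol η₀ k) f) g →
      ∃ G : Rd d → ℂ, Measurable G ∧ g =ᵐ[volume] G ∧ ∀ (i : Fin d) (x : Fin d → ℝ),
        ‖G (WithLp.toLp 2 x)‖ₑ ^ r ≤ C * ∫⁻ y,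
          ‖G (WithLp.toLp 2 (Function.update x i y))‖ₑ ^ r * dyadicWeight (k i) (x i - y) := by
  obtain ⟨N, hN⟩ := exists_nat_ge (2 / r)
  have hN' : 2 ≤ N * r := (div_le_iff₀ hr).1 hN
  set κ : 𝓢(ℝ, ℂ) := 𝓕⁻ (univariateLowpass h0) with hκ
  obtain ⟨D, hD, hκD⟩ := exists_enorm_dilate_le κ N
  refine ⟨D, hD, fun k f g hg => ?_⟩
  let b : ℕ → ContDiffBump (0 : Rd d) := fun n =>
    ⟨1 / (2 * (n + 20)), 1 / (n + 20), by positivity, by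
      rw [div_lt_div_iff_of_pos_left one_pos (by positivity) (by positivity)]
      have : (0 : ℝ) ≤ n := n.cast_nonneg
      linarith⟩
  have hb : ∀ n, (b n).rOut ≤ 1 / 20 := fun n => by
    change (1 : ℝ) / (n + 20) ≤ 1 / 20
    gcongr
    have : (0 : ℝ) ≤ n := n.cast_nonneg
    linarith
  have hbt : Tendsto (fun n => (b n).rOut) atTop (𝓝 0) := by
    change Tendsto (fun n : ℕ => (1 : ℝ) / (n + 20)) atTop (𝓝 0)
    exact (tendsto_const_nhds (x := (1 : ℝ))).div_atTop
      (tendsto_atTop_add_const_right _ _ tendsto_natCast_atTop_atTop)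
  set θ := fun n => fourierBump (b n) with hθ
  set H := fun n => smoothing (lowpass h0 k) fun x => θ n x * g x with hH
  have hHae : ∀ n, (fun x => θ n x * g x) =ᵐ[volume] H n := fun n =>
    ae_eq_smoothing h0 hg (b n) (hb n)
  have hHi : ∀ n, Integrable fun x => θ n x * g x := fun n => (hg (θ n)).1
  have hHc : ∀ n, Continuous (H n) := fun n => continuous_smoothing (hHi n)
  have hθt : ∀ x, Tendsto (fun n => θ n x) atTop (𝓝 1) := tendsto_fourierBump hbt
  -- Both sides equal `θ m * θ n * g` almost everywhere and are continuous, hence agree everywhere.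
  -- So the quotient `H m x / θ m x` does not depend on `m`.
  have hcomm : ∀ m n x, θ m x * H n x = θ n x * H m x := by
    intro m n
    refine congr_fun ((Continuous.ae_eq_iff_eq volume ((θ m).continuous.mul (hHc n))
      ((θ n).continuous.mul (hHc m))).1 ?_)
    filter_upwards [hHae m, hHae n] with x hm hn
    simp only [Pi.mul_apply]
    rw [← hm, ← hn]
    ring
  have hlim : ∀ x, ∃ G, ∀ n, H n x = θ n x * G := by
    intro x
    obtain ⟨m, hm⟩ := ((hθt x).eventually_ne one_ne_zero).exists
    refine ⟨H m x / θ m x, fun n => ?_⟩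
    field_simp
    rw [mul_comm]
    exact hcomm m n x
  choose G hG using hlim
  have hGt : ∀ x, Tendsto (fun n => H n x) atTop (𝓝 (G x)) := fun x => by
    simpa [hG] using (hθt x).mul_const (G x)
  have hGm : Measurable G :=
    measurable_of_tendsto_metrizable (fun n => (hHc n).measurable) (tendsto_pi_nhds.2 hGt)
  refine ⟨G, hGm, ?_, fun i x => ?_⟩
  · filter_upwards [ae_all_iff.2 hHae] with x hx
    refine tendsto_nhds_unique ?_ (hGt x)
    simp only [← hx]
    simpa using (hθt x).mul_const (g x)
  · have hn : ∀ n, ‖H n (WithLp.toLp 2 x)‖ₑ ^ r ≤ D * ∫⁻ y,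
        ‖G (WithLp.toLp 2 (Function.update x i y))‖ₑ ^ r * dyadicWeight (k i) (x i - y) := by
      intro n
      obtain ⟨B, hB⟩ := norm_smoothing_le (Λ := lowpass h0 k) (hHi n)
      have hline : ∀ t y : ℝ, (WithLp.toLp 2 (Function.update x i (t - y)) : Rd d) =
          WithLp.toLp 2 (Function.update x i t) - EuclideanSpace.single i y := by
        intro t y
        ext j
        by_cases hj : j = i
        · subst hj; simp
        · simp [hj]
      have key := rpow_enorm_le_of_eq_convolution hr hr1 hN' (k i) (B := ENNReal.ofReal B)
        ENNReal.ofReal_ne_top (hκD (k i)) (K := dilate κ (k i))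
        (ℓ := fun t => H n (WithLp.toLp 2 (Function.update x i t)))
        (fun t => by
          rw [← ofReal_norm]
          exact ENNReal.ofReal_le_ofReal (hB _))
        ((hHc n).measurable.comp ((WithLp.measurable_toLp 2 _).comp (measurable_update x)))
        (fun t => by
          simp only [hline]
          refine smoothing_eq_integral_sub_single (integrable_dilate κ (k i))
            (m := fun σ => univariateLowpass h0 (σ / 2 ^ k i)) (fun σ => ?_) i
            (univariateLowpass_mul_lowpass h0 k i) (hHi n) _
          rw [integral_dilate, hκ, FourierTransform.fourier_fourierInv_eq]) (x i)
      simp only [Function.update_eq_self] at key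
      -- Since `‖θ n‖ ≤ 1`, the right-hand side can be bounded by `G` at once; a limit is then
      -- needed on the left only.
      refine key.trans ?_
      gcongr with y
      rw [hG, enorm_mul]
      refine mul_le_of_le_one_left' ?_
      rw [← ofReal_norm, ENNReal.ofReal_le_one]
      exact norm_fourierBump_le _ _
    have ht : Tendsto (fun n => ‖H n (WithLp.toLp 2 x)‖ₑ ^ r) atTop
        (𝓝 (‖G (WithLp.toLp 2 x)‖ₑ ^ r)) :=
      (ENNReal.continuous_rpow_const.tendsto _).comp ((continuous_enorm.tendsto _).comp (hGt _))
    exact le_of_tendsto ht (Eventually.of_forall hn)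

end MeanValueProperty

/-! ### Embeddings between spaces of dominating mixed smoothness -/

section lq

variable {ι : Type}

theorem le_lqNorm {q : ℝ≥0∞} (hq : 0 < q) (a : ι → ℝ≥0∞) (k : ι) : a k ≤ lqNorm q a := by
  unfold lqNorm
  split_ifs with h
  · exact le_iSup a k
  · have hq' : 0 < q.toReal := ENNReal.toReal_pos hq.ne' h
    calc a k = (a k ^ q.toReal) ^ (1 / q.toReal) := by
          rw [← ENNReal.rpow_mul, mul_one_div_cancel hq'.ne', ENNReal.rpow_one]
      _ ≤ _ := ENNReal.rpow_le_rpow (ENNReal.le_tsum k) (by positivity)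

theorem lqNorm_le_lqNorm_of_le {q q₀ : ℝ≥0∞} (hq : 0 < q) (hqq : q ≤ q₀) (a : ι → ℝ≥0∞) :
    lqNorm q₀ a ≤ lqNorm q a := by
  by_cases h₀ : q₀ = ⊤
  · rw [lqNorm, if_pos h₀]
    exact iSup_le (le_lqNorm hq a)
  have h : q ≠ ⊤ := ne_top_of_le_ne_top h₀ hqq
  have hq' : 0 < q.toReal := ENNReal.toReal_pos hq.ne' h
  have hqq' : q.toReal ≤ q₀.toReal := ENNReal.toReal_mono h₀ hqq
  have hq₀' : 0 < q₀.toReal := hq'.trans_le hqq'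
  rw [lqNorm, if_neg h₀, lqNorm, if_neg h]
  set S := ∑' k, a k ^ q.toReal with hS
  have hsum : ∑' k, a k ^ q₀.toReal ≤ S ^ (q₀.toReal / q.toReal) := by
    have he : 0 ≤ q₀.toReal / q.toReal - 1 := by rwa [sub_nonneg, one_le_div hq']
    calc ∑' k, a k ^ q₀.toReal ≤ ∑' k, a k ^ q.toReal * S ^ (q₀.toReal / q.toReal - 1) := by
          refine ENNReal.tsum_le_tsum fun k => ?_
          calc a k ^ q₀.toReal
              = a k ^ q.toReal * (a k ^ q.toReal) ^ (q₀.toReal / q.toReal - 1) := by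
                rw [← ENNReal.rpow_mul, ← ENNReal.rpow_add_of_nonneg _ _ hq'.le (by positivity)]
                congr 1
                field_simp
                ring
            _ ≤ _ := by
                gcongr
                exact ENNReal.le_tsum k
      _ = S ^ (1 : ℝ) * S ^ (q₀.toReal / q.toReal - 1) := by
          rw [ENNReal.tsum_mul_right, ENNReal.rpow_one]
      _ = _ := by
          rw [← ENNReal.rpow_add_of_nonneg _ _ zero_le_one he]
          congr 1
          ring
  calc _ ≤ (S ^ (q₀.toReal / q.toReal)) ^ (1 / q₀.toReal) :=
        ENNReal.rpow_le_rpow hsum (by positivity)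
    _ = _ := by
        rw [← ENNReal.rpow_mul]
        congr 1
        field_simp

theorem lqNorm_le_tsum_rpow {q : ℝ≥0∞} {r : ℝ} (hr : 0 < r) (hrq : ENNReal.ofReal r ≤ q)
    (a : ι → ℝ≥0∞) : lqNorm q a ≤ (∑' k, a k ^ r) ^ (1 / r) := by
  refine (lqNorm_le_lqNorm_of_le (ENNReal.ofReal_pos.2 hr) hrq a).trans (le_of_eq ?_)
  rw [lqNorm, if_neg ENNReal.ofReal_ne_top, ENNReal.toReal_ofReal hr.le]

end lq

/-- Passing to `r`-th powers, `r ≤ 1` serves the mean value inequality, `r ≤ p` makes `p / r ≥ 1`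
for Minkowski, and the last bound allows `ℓ_q` to be estimated by `ℓ_r`. -/
theorem exists_exponent {p : ℝ} (hp : 0 < p) {q : ℝ≥0∞} (hq : 0 < q) :
    ∃ r : ℝ, 0 < r ∧ r ≤ 1 ∧ r ≤ p ∧ ENNReal.ofReal r ≤ q := by
  refine ⟨min (min 1 p) (min q 1).toReal, ?_, ?_, ?_, ?_⟩
  · refine lt_min (lt_min one_pos hp) (ENNReal.toReal_pos ?_ ?_)
    · exact (lt_min hq one_pos).ne'
    · exact ne_top_of_le_ne_top ENNReal.one_ne_top (min_le_right _ _)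
  · exact (min_le_left _ _).trans (min_le_left _ _)
  · exact (min_le_left _ _).trans (min_le_right _ _)
  · calc _ ≤ ENNReal.ofReal (min q 1).toReal := ENNReal.ofReal_le_ofReal (min_le_right _ _)
      _ = min q 1 := ENNReal.ofReal_toReal
          (ne_top_of_le_ne_top ENNReal.one_ne_top (min_le_right _ _))
      _ ≤ q := min_le_left _ _

variable {d : ℕ} {η₀ : ℝ → ℂ}

theorem exists_isGivenBy_of_distLpLqNorm_lt_top {ι : Type} {p : ℝ} {q : ℝ≥0∞} {w : ι → ℝ≥0∞}
    {T : ι → 𝓢'(Rd d, ℂ)} (h : distLpLqNorm p q w T < ⊤) :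
    ∃ g : ι → Rd d → ℂ, ∀ k, IsGivenBy (T k) (g k) := by
  by_contra! hg
  refine h.ne ?_
  simp only [distLpLqNorm, iInf_eq_top]
  intro g hg'
  obtain ⟨k, hk⟩ := hg g
  exact absurd (hg' k) hk

/-- Both quasi-norms are built from the same pieces of `f`, so one family of representing functions
serves for both. -/
theorem embeds_normSF_of_LpLqNorm_le {t p t₀ p₀ : ℝ} {q q₀ : ℝ≥0∞} {C : ℝ≥0∞} (hC : C ≠ ⊤)
    (h : ∀ (f : 𝓢'(Rd d, ℂ)) (g : (Fin d → ℕ) → Rd d → ℂ),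
      (∀ k, IsGivenBy (multiplier (mixSymbol η₀ k) f) (g k)) →
      LpLqNorm p₀ q₀ (fun k : Fin d → ℕ => (2 : ℝ≥0∞) ^ (((∑ i, k i : ℕ) : ℝ) * t₀)) g ≤
        C * LpLqNorm p q (fun k : Fin d → ℕ => (2 : ℝ≥0∞) ^ (((∑ i, k i : ℕ) : ℝ) * t)) g) :
    Embeds (normSF (d := d) η₀ t p q) (normSF η₀ t₀ p₀ q₀) := by
  have key : ∀ f ∈ space (normSF (d := d) η₀ t p q),
      normSF η₀ t₀ p₀ q₀ f ≤ C * normSF η₀ t p q f := by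
    intro f hf
    obtain ⟨g, hg⟩ := exists_isGivenBy_of_distLpLqNorm_lt_top hf
    rw [normSF, normSF, distLpLqNorm_eq _ _ _ hg, distLpLqNorm_eq _ _ _ hg]
    exact h f g hg
  refine ⟨fun f hf => (key f hf).trans_lt (ENNReal.mul_lt_top hC.lt_top hf), C.toNNReal, ?_⟩
  rwa [ENNReal.coe_toNNReal hC]

theorem embeds_normSF_of_exponent_le {t p : ℝ} (hp : 0 < p) {q q₀ : ℝ≥0∞} (hq : 0 < q)
    (hqq : q ≤ q₀) :
    Embeds (normSF (d := d) η₀ t p q) (normSF η₀ t p q₀) := by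
  refine embeds_normSF_of_LpLqNorm_le (C := 1) (by simp) fun f g _ => ?_
  rw [one_mul]
  refine ENNReal.rpow_le_rpow (lintegral_mono fun x => ?_) (by positivity)
  exact ENNReal.rpow_le_rpow (lqNorm_le_lqNorm_of_le hq hqq _) hp.le

/-- The sum is a product of `d` geometric series, computed as the total mass of a product of copies
of `dyadicMeasure β`. -/
theorem tsum_rpow_neg_sum_ne_top {β : ℝ} (hβ : 0 < β) :
    ∑' k : Fin d → ℕ, (2 : ℝ≥0∞) ^ (-(((∑ i, k i : ℕ) : ℝ) * β)) ≠ ⊤ := by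
  have h1 : dyadicMeasure β Set.univ ≠ ⊤ := by
    have h2 : (2 : ℝ≥0∞) ^ (-β) < 1 :=
      ENNReal.rpow_lt_one_of_one_lt_of_neg (by norm_num) (by linarith)
    rw [← lintegral_one, lintegral_dyadicMeasure]
    have : ∀ m : ℕ, (2 : ℝ≥0∞) ^ (-((m : ℝ) * β)) * 1 = ((2 : ℝ≥0∞) ^ (-β)) ^ m := by
      intro m
      rw [← ENNReal.rpow_natCast, ← ENNReal.rpow_mul, mul_one]
      congr 1
      ring
    simp only [this, ENNReal.tsum_geometric]
    exact ENNReal.inv_ne_top.2 (tsub_pos_of_lt h2).ne'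
  have h3 : Measure.pi (fun _ : Fin d => dyadicMeasure β) Set.univ ≠ ⊤ := by
    rw [Measure.pi_univ]
    exact ENNReal.prod_ne_top fun _ _ => h1
  rw [← lintegral_one, lintegral_countable'] at h3
  convert h3 using 3 with k
  rw [Measure.pi_singleton, one_mul]
  exact (prod_dyadicMeasure_singleton β k Finset.univ).symm

/-- Each weighted term at smoothness `t` is at most the whole `ℓ_q` norm, and the surplus `t - t₀`
supplies a summable factor. This is why `q` and `q₀` are unrelated. -/
theorem embeds_normSF_of_smoothness_lt {t t₀ p : ℝ} (hp : 0 < p) (ht : t₀ < t) {q q₀ : ℝ≥0∞}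
    (hq : 0 < q) (hq₀ : 0 < q₀) :
    Embeds (normSF (d := d) η₀ t p q) (normSF η₀ t₀ p q₀) := by
  obtain ⟨r, hr, hr1, hrp, hrq⟩ := exists_exponent hp hq₀
  set S := ∑' k : Fin d → ℕ, (2 : ℝ≥0∞) ^ (-(((∑ i, k i : ℕ) : ℝ) * ((t - t₀) * r))) with hS
  have hSt : S ≠ ⊤ := tsum_rpow_neg_sum_ne_top (mul_pos (by linarith) hr)
  have hS' : S ^ (1 / r) ≠ ⊤ := ENNReal.rpow_ne_top_of_nonneg (by positivity) hSt
  refine embeds_normSF_of_LpLqNorm_le hS' fun f g _ => ?_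
  set w : (Fin d → ℕ) → ℝ≥0∞ := fun k => (2 : ℝ≥0∞) ^ (((∑ i, k i : ℕ) : ℝ) * t) with hw
  have key : ∀ x, lqNorm q₀ (fun k : Fin d → ℕ =>
      (2 : ℝ≥0∞) ^ (((∑ i, k i : ℕ) : ℝ) * t₀) * ‖g k x‖ₑ) ≤
      S ^ (1 / r) * lqNorm q (fun k => w k * ‖g k x‖ₑ) := by
    intro x
    set Q := lqNorm q (fun k => w k * ‖g k x‖ₑ) with hQ
    refine (lqNorm_le_tsum_rpow hr hrq _).trans ?_
    calc _ ≤ (∑' k : Fin d → ℕ,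
          (2 : ℝ≥0∞) ^ (-(((∑ i, k i : ℕ) : ℝ) * ((t - t₀) * r))) * Q ^ r) ^ (1 / r) := by
          refine ENNReal.rpow_le_rpow (ENNReal.tsum_le_tsum fun k => ?_) (by positivity)
          have e : (2 : ℝ≥0∞) ^ (((∑ i, k i : ℕ) : ℝ) * t₀) =
              2 ^ (-(((∑ i, k i : ℕ) : ℝ) * (t - t₀))) * w k := by
            rw [hw, ← ENNReal.rpow_add _ _ (by simp) (by simp)]
            congr 1
            ring
          rw [e, mul_assoc, ENNReal.mul_rpow_of_nonneg _ _ hr.le, ← ENNReal.rpow_mul]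
          have e2 : -(((∑ i, k i : ℕ) : ℝ) * (t - t₀)) * r =
            -(((∑ i, k i : ℕ) : ℝ) * ((t - t₀) * r)) := by ring
          rw [e2]
          gcongr
          exact le_lqNorm hq (fun k => w k * ‖g k x‖ₑ) k
      _ = _ := by
          rw [ENNReal.tsum_mul_right, ENNReal.mul_rpow_of_nonneg _ _ (by positivity),
            ← ENNReal.rpow_mul, mul_one_div_cancel hr.ne', ENNReal.rpow_one]
  calc _ ≤ (∫⁻ x, (S ^ (1 / r) * lqNorm q (fun k => w k * ‖g k x‖ₑ)) ^ p) ^ (1 / p) :=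
        ENNReal.rpow_le_rpow (lintegral_mono fun x => ENNReal.rpow_le_rpow (key x) hp.le)
          (by positivity)
    _ = _ := by
        simp_rw [ENNReal.mul_rpow_of_nonneg _ _ hp.le]
        rw [lintegral_const_mul' _ _ (ENNReal.rpow_ne_top_of_nonneg hp.le hS'),
          ENNReal.mul_rpow_of_nonneg _ _ (by positivity), ← ENNReal.rpow_mul _ p,
          mul_one_div_cancel hp.ne', ENNReal.rpow_one]
        rfl

/-- The embedding of Jawerth type for spaces of dominating mixed smoothness. -/
theorem embeds_normSF_of_integrability_lt (h0 : IsUnivariateGenerator η₀) {t t₀ p p₀ : ℝ}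
    (hp : 0 < p) (hpp : p < p₀) (ht : t₀ - 1 / p₀ ≤ t - 1 / p) {q q₀ : ℝ≥0∞}
    (hq : 0 < q) (hq₀ : 0 < q₀) :
    Embeds (normSF (d := d) η₀ t p q) (normSF η₀ t₀ p₀ q₀) := by
  have hp₀ : 0 < p₀ := hp.trans hpp
  obtain ⟨r, hr, hr1, hrp, hrq⟩ := exists_exponent hp hq₀
  obtain ⟨C₀, hC₀, hmv⟩ := exists_meanValueProperty (d := d) h0 hr hr1
  have hs : 1 ≤ p / r := (one_le_div hr).2 hrp
  have hss : p / r < p₀ / r := div_lt_div_of_pos_right hpp hr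
  obtain ⟨C, hC, hJ⟩ := exists_lintegral_tsum_le (ι := Fin d) hs hss hC₀
  refine embeds_normSF_of_LpLqNorm_le (C := C ^ (1 / r))
    (ENNReal.rpow_ne_top_of_nonneg (by positivity) hC) fun f g hg => ?_
  choose G hGm hgG hGmv using fun k => hmv k f (g k) (hg k)
  -- The critical smoothness for the target; the weight for `t` dominates the one for `t'`. With `A`
  -- weighted by `t' * r`, the factor `2 ^ (-|k|₁ β)` in the Jawerth bound leaves exactly `t₀ * r`.
  set t' := t₀ + 1 / p - 1 / p₀ with ht'
  have htt' : t' ≤ t := by rw [ht']; linarith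
  set β := 1 / (p / r) - 1 / (p₀ / r) with hβ
  let A : (Fin d → ℕ) → (Fin d → ℝ) → ℝ≥0∞ := fun k x =>
    (2 : ℝ≥0∞) ^ (((∑ i, k i : ℕ) : ℝ) * (t' * r)) * ‖G k (WithLp.toLp 2 x)‖ₑ ^ r
  have hAm : ∀ k, Measurable (A k) := fun k =>
    (((hGm k).comp (WithLp.measurable_toLp 2 _)).enorm.pow_const r).const_mul _
  have hAmv : HasMeanValueProperty C₀ A := by
    intro k i x
    have hm : Measurable fun y => ‖G k (WithLp.toLp 2 (Function.update x i y))‖ₑ ^ r *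
        dyadicWeight (k i) (x i - y) :=
      (((hGm k).comp ((WithLp.measurable_toLp 2 _).comp
        (measurable_update x))).enorm.pow_const r).mul
        ((measurable_dyadicWeight _).comp (measurable_const.sub measurable_id))
    simp only [A]
    generalize (2 : ℝ≥0∞) ^ (((∑ i, k i : ℕ) : ℝ) * (t' * r)) = W
    simp only [mul_assoc]
    rw [lintegral_const_mul _ hm, mul_left_comm C₀]
    exact mul_le_mul_right (hGmv k i x) W
  have h1 := hJ A hAm hAmv
  have hmp := PiLp.volume_preserving_toLp (Fin d)
  have hemb : MeasurableEmbedding (WithLp.toLp 2 : (Fin d → ℝ) → Rd d) :=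
    (MeasurableEquiv.toLp 2 (Fin d → ℝ)).measurableEmbedding
  have hleft : LpLqNorm p₀ q₀ (fun k : Fin d → ℕ => (2 : ℝ≥0∞) ^ (((∑ i, k i : ℕ) : ℝ) * t₀)) g ≤
      ((∫⁻ x, (∑' k, (2 : ℝ≥0∞) ^ (-(((∑ i, k i : ℕ) : ℝ) * β)) * A k x) ^ (p₀ / r))
          ^ (1 / (p₀ / r))) ^ (1 / r) := by
    have e : 1 / (p₀ / r) * (1 / r) = 1 / p₀ := by field_simp
    rw [← ENNReal.rpow_mul, e]
    refine ENNReal.rpow_le_rpow ?_ (by positivity)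
    rw [← hmp.lintegral_comp_emb hemb]
    have hae : ∀ᵐ x : Fin d → ℝ, ∀ k, g k (WithLp.toLp 2 x) = G k (WithLp.toLp 2 x) :=
      hmp.quasiMeasurePreserving.ae (ae_all_iff.2 hgG)
    refine lintegral_mono_ae ?_
    filter_upwards [hae] with x hx
    refine (ENNReal.rpow_le_rpow (lqNorm_le_tsum_rpow hr hrq _) hp₀.le).trans (le_of_eq ?_)
    rw [← ENNReal.rpow_mul]
    congr 1
    · refine tsum_congr fun k => ?_
      simp only [A, hx]
      rw [ENNReal.mul_rpow_of_nonneg _ _ hr.le, ← ENNReal.rpow_mul, ← mul_assoc,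
        ← ENNReal.rpow_add _ _ (by simp) (by simp)]
      congr 2
      rw [hβ, ht']
      field_simp
      ring
    · ring
  have hright : ((∫⁻ x, (⨆ k, A k x) ^ (p / r)) ^ (1 / (p / r))) ^ (1 / r) ≤
      LpLqNorm p q (fun k : Fin d → ℕ => (2 : ℝ≥0∞) ^ (((∑ i, k i : ℕ) : ℝ) * t)) g := by
    have e : 1 / (p / r) * (1 / r) = 1 / p := by field_simp
    rw [← ENNReal.rpow_mul, e]
    refine ENNReal.rpow_le_rpow ?_ (by positivity)
    rw [← hmp.lintegral_comp_emb hemb]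
    have hae : ∀ᵐ x : Fin d → ℝ, ∀ k, g k (WithLp.toLp 2 x) = G k (WithLp.toLp 2 x) :=
      hmp.quasiMeasurePreserving.ae (ae_all_iff.2 hgG)
    refine lintegral_mono_ae ?_
    filter_upwards [hae] with x hx
    set Q := lqNorm q (fun k : Fin d → ℕ =>
      (2 : ℝ≥0∞) ^ (((∑ i, k i : ℕ) : ℝ) * t) * ‖g k (WithLp.toLp 2 x)‖ₑ) with hQ
    have h2 : ⨆ k, A k x ≤ Q ^ r := by
      refine iSup_le fun k => ?_
      have h3 := le_lqNorm hq (fun k : Fin d → ℕ =>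
        (2 : ℝ≥0∞) ^ (((∑ i, k i : ℕ) : ℝ) * t) * ‖g k (WithLp.toLp 2 x)‖ₑ) k
      refine le_trans ?_ (ENNReal.rpow_le_rpow h3 hr.le)
      simp only [A, hx]
      rw [ENNReal.mul_rpow_of_nonneg _ _ hr.le, ← ENNReal.rpow_mul]
      refine mul_le_mul_left (ENNReal.rpow_le_rpow_of_exponent_le (by norm_num) ?_) _
      rw [mul_assoc]
      gcongr
    calc (⨆ k, A k x) ^ (p / r) ≤ (Q ^ r) ^ (p / r) :=
          ENNReal.rpow_le_rpow h2 (by positivity)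
      _ = Q ^ p := by
          rw [← ENNReal.rpow_mul]
          congr 1
          field_simp
  refine hleft.trans ((ENNReal.rpow_le_rpow h1 (by positivity)).trans ?_)
  rw [ENNReal.mul_rpow_of_nonneg _ _ (by positivity : 0 ≤ 1 / r)]
  gcongr

section Necessity

open scoped FourierTransform
open Filter Topology

variable {d : ℕ}

/-! ### Test functions -/

/-- On the spectrum of each `F n` the symbol is the scalar `c n`, so the multiplier acts on the sum
termwise by scalars. -/
theorem isGivenBy_multiplier_sum {m : Rd d → ℂ}
    (hm : (fun ξ => m ((2 * Real.pi) • ξ)).HasTemperateGrowth) {S : Finset ℕ}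
    {F : ℕ → 𝓢(Rd d, ℂ)} {c : ℕ → ℂ}
    (hF : ∀ n ∈ S, ∀ ξ, m ((2 * Real.pi) • ξ) * 𝓕 (F n) ξ = c n * 𝓕 (F n) ξ) :
    IsGivenBy (multiplier m (SchwartzMap.toTemperedDistributionCLM (Rd d) ℂ volume
      (∑ n ∈ S, F n))) fun x => ∑ n ∈ S, c n * F n x := by
  have e : multiplier m (SchwartzMap.toTemperedDistributionCLM (Rd d) ℂ volume (∑ n ∈ S, F n)) =
      SchwartzMap.toTemperedDistributionCLM (Rd d) ℂ volume (∑ n ∈ S, c n • F n) := by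
    rw [multiplier, TemperedDistribution.fourierMultiplierCLM_toTemperedDistributionCLM_eq hm,
      map_sum]
    congr 1
    refine Finset.sum_congr rfl fun n hn => ?_
    rw [SchwartzMap.fourierMultiplierCLM_apply]
    have : SchwartzMap.smulLeftCLM ℂ (fun ξ => m ((2 * Real.pi) • ξ)) (𝓕 (F n)) =
        𝓕 (c n • F n) := by
      ext ξ
      rw [SchwartzMap.smulLeftCLM_apply_apply hm, FourierTransform.fourier_smul]
      exact hF n hn ξ
    rw [this, FourierTransform.fourierInv_fourier_eq]
  intro u
  have e2 : ∀ x, (∑ n ∈ S, c n • F n) x = ∑ n ∈ S, c n * F n x := fun x => by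
    simp
  rw [e]
  refine ⟨?_, ?_⟩
  · obtain ⟨C, hC⟩ := exists_norm_schwartzMap_le (∑ n ∈ S, c n • F n)
    have := (u.integrable (μ := volume)).mul_bdd (c := C)
      (∑ n ∈ S, c n • F n).continuous.aestronglyMeasurable (Eventually.of_forall hC)
    simpa only [e2] using this
  · refine (SchwartzMap.toTemperedDistributionCLM_apply_apply volume _ u).trans ?_
    simp only [smul_eq_mul, e2]

theorem lqNorm_indicator {ι : Type} (q : ℝ≥0∞) (hq : 0 < q) {A : Finset ι} (hA : A.Nonempty)
    (a : ι → ℝ≥0∞) (v : ℝ≥0∞) (ha : ∀ k ∈ A, a k = v) (ha' : ∀ k ∉ A, a k = 0) :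
    lqNorm q a = (A.card : ℝ≥0∞) ^ (1 / q.toReal) * v := by
  unfold lqNorm
  split_ifs with h
  · simp only [h, ENNReal.toReal_top, div_zero, ENNReal.rpow_zero, one_mul]
    obtain ⟨k₀, hk₀⟩ := hA
    refine le_antisymm (iSup_le fun k => ?_) ((ha k₀ hk₀).symm.le.trans (le_iSup a k₀))
    by_cases hk : k ∈ A
    · exact (ha k hk).le
    · rw [ha' k hk]; exact zero_le
  · have hq' : 0 < q.toReal := ENNReal.toReal_pos hq.ne' h
    have : ∑' k, a k ^ q.toReal = A.card * v ^ q.toReal := by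
      rw [tsum_eq_sum (s := A) fun k hk => by rw [ha' k hk, ENNReal.zero_rpow_of_pos hq'],
        Finset.sum_congr rfl fun k hk => by rw [ha k hk], Finset.sum_const, nsmul_eq_mul]
    rw [this, ENNReal.mul_rpow_of_nonneg _ _ (by positivity), ← ENNReal.rpow_mul,
      mul_one_div_cancel hq'.ne', ENNReal.rpow_one]

/-- Each `F n` occupies only the piece `κ n`, and all weighted moduli coincide. Pointwise, the `ℓ_q`
norm is that of `S.card` equal entries. -/
theorem distLpLqNorm_test {ι : Type} [Countable ι] [DecidableEq ι] {p : ℝ} (hp : 0 < p)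
    {q : ℝ≥0∞} (hq : 0 < q) {w : ι → ℝ≥0∞} {m : ι → Rd d → ℂ}
    (hm : ∀ k, (fun ξ => m k ((2 * Real.pi) • ξ)).HasTemperateGrowth) {S : Finset ℕ}
    (hS : S.Nonempty) {F : ℕ → 𝓢(Rd d, ℂ)} {κ : ℕ → ι} (hκ : Set.InjOn κ S)
    (hF : ∀ n ∈ S, ∀ k ξ, m k ((2 * Real.pi) • ξ) * 𝓕 (F n) ξ =
      (if k = κ n then 1 else 0) * 𝓕 (F n) ξ)
    {V : ℝ≥0∞} (hV : V ≠ ⊤) {Φ : Rd d → ℝ≥0∞} (hΦ : ∀ n ∈ S, ∀ x, w (κ n) * ‖F n x‖ₑ = V * Φ x) :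
    distLpLqNorm p q w (fun k => multiplier (m k)
      (SchwartzMap.toTemperedDistributionCLM (Rd d) ℂ volume (∑ n ∈ S, F n))) =
      (S.card : ℝ≥0∞) ^ (1 / q.toReal) * V * (∫⁻ x, Φ x ^ p) ^ (1 / p) := by
  rw [distLpLqNorm_eq p q w fun k => isGivenBy_multiplier_sum (hm k)
    (c := fun n => if k = κ n then 1 else 0) fun n hn => hF n hn k]
  have hlq : ∀ x, lqNorm q (fun k => w k *
      ‖∑ n ∈ S, (if k = κ n then (1 : ℂ) else 0) * F n x‖ₑ) =
      (S.card : ℝ≥0∞) ^ (1 / q.toReal) * (V * Φ x) := by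
    intro x
    rw [← Finset.card_image_of_injOn hκ]
    refine lqNorm_indicator q hq (hS.image κ) _ _ (fun k hk => ?_) (fun k hk => ?_)
    · obtain ⟨n, hn, rfl⟩ := Finset.mem_image.1 hk
      rw [Finset.sum_eq_single n, if_pos rfl, one_mul, hΦ n hn]
      · intro n' hn' hne
        rw [if_neg fun h => hne (hκ hn' hn h.symm), zero_mul]
      · exact fun h => absurd hn h
    · rw [Finset.sum_eq_zero, enorm_zero, mul_zero]
      intro n hn
      rw [if_neg fun h => hk (Finset.mem_image.2 ⟨n, hn, h.symm⟩), zero_mul]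
  have hc : (S.card : ℝ≥0∞) ^ (1 / q.toReal) * V ≠ ⊤ :=
    ENNReal.mul_ne_top (ENNReal.rpow_ne_top_of_nonneg (by positivity) (by simp)) hV
  simp only [LpLqNorm, hlq, ← mul_assoc]
  simp_rw [ENNReal.mul_rpow_of_nonneg _ _ hp.le]
  rw [← ENNReal.mul_rpow_of_nonneg _ _ hp.le,
    lintegral_const_mul' _ _ (ENNReal.rpow_ne_top_of_nonneg hp.le hc),
    ENNReal.mul_rpow_of_nonneg _ _ (by positivity), ← ENNReal.rpow_mul _ p,
    mul_one_div_cancel hp.ne', ENNReal.rpow_one]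

theorem lintegral_rpow_enorm_lt_top (ψ : 𝓢(Rd d, ℂ)) {p : ℝ} (hp : 0 < p) :
    ∫⁻ x, ‖ψ x‖ₑ ^ p < ⊤ := by
  obtain ⟨N, hN⟩ := exists_nat_gt (d / p)
  have hN' : (d : ℝ) < N * p := (div_lt_iff₀ hp).1 hN
  set C := 2 ^ N * (Finset.Iic (N, 0)).sup (fun m => SchwartzMap.seminorm ℝ m.1 m.2) ψ with hC
  have hb : ∀ x, ‖ψ x‖ₑ ^ p ≤ ENNReal.ofReal C ^ p *
      ENNReal.ofReal ((1 + ‖x‖) ^ (-(N * p))) := by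
    intro x
    have h := SchwartzMap.one_add_le_sup_seminorm_apply (𝕜 := ℝ) (m := (N, 0)) (k := N) (n := 0)
      le_rfl le_rfl ψ x
    rw [norm_iteratedFDeriv_zero] at h
    have h1 : (0 : ℝ) < 1 + ‖x‖ := by positivity
    have h2 : ‖ψ x‖ ≤ C * (1 + ‖x‖) ^ (-(N : ℝ)) := by
      rw [Real.rpow_neg h1.le, ← div_eq_mul_inv, Real.rpow_natCast, le_div_iff₀ (by positivity),
        mul_comm]
      exact h
    have hC0 : 0 ≤ C := nonneg_of_mul_nonneg_left ((norm_nonneg _).trans h2) (by positivity)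
    have h3 := ENNReal.rpow_le_rpow (ENNReal.ofReal_le_ofReal h2) hp.le
    rw [ofReal_norm, ENNReal.ofReal_mul hC0, ENNReal.mul_rpow_of_nonneg _ _ hp.le,
      ENNReal.ofReal_rpow_of_pos (x := (1 + ‖x‖) ^ (-(N : ℝ))) (by positivity),
      ← Real.rpow_mul h1.le, neg_mul] at h3
    exact h3
  refine (lintegral_mono hb).trans_lt ?_
  rw [lintegral_const_mul' _ _ (ENNReal.rpow_ne_top_of_nonneg hp.le ENNReal.ofReal_ne_top)]
  refine ENNReal.mul_lt_top (ENNReal.rpow_ne_top_of_nonneg hp.le ENNReal.ofReal_ne_top).lt_top ?_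
  exact finite_integral_one_add_norm (by simpa using hN')

/-- The bump function `b((ξ - ξ₀)/l)` as a Schwartz function. -/
noncomputable def scaledBump (b : ContDiffBump (0 : Rd d)) (ξ₀ : Rd d) (l : ℝ) (hl : 0 < l) :
    𝓢(Rd d, ℂ) :=
  HasCompactSupport.toSchwartzMap (f := fun ξ => ((b (l⁻¹ • (ξ - ξ₀)) : ℝ) : ℂ))
    (HasCompactSupport.intro (isCompact_closedBall ξ₀ (l * b.rOut)) fun ξ hξ => by
      rw [b.zero_of_le_dist, Complex.ofReal_zero]
      rw [Metric.mem_closedBall, dist_eq_norm, not_le] at hξ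
      rw [dist_zero_right, norm_smul, norm_inv, Real.norm_eq_abs, abs_of_pos hl,
        le_inv_mul_iff₀ hl]
      exact hξ.le)
    (Complex.ofRealCLM.contDiff.comp (b.contDiff.comp (by fun_prop)))

theorem norm_sub_le_of_scaledBump_ne_zero {b : ContDiffBump (0 : Rd d)} {ξ₀ ξ : Rd d} {l : ℝ}
    {hl : 0 < l} (h : scaledBump b ξ₀ l hl ξ ≠ 0) : ‖ξ - ξ₀‖ ≤ l * b.rOut := by
  by_contra! hξ
  refine h ?_
  change ((b (l⁻¹ • (ξ - ξ₀)) : ℝ) : ℂ) = 0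
  rw [b.zero_of_le_dist, Complex.ofReal_zero]
  rw [dist_zero_right, norm_smul, norm_inv, Real.norm_eq_abs, abs_of_pos hl, le_inv_mul_iff₀ hl]
  exact hξ.le

/-- Moving the bump in frequency only multiplies by a unimodular character; its dilation gives the
factor `l ^ d` and the rescaled argument. -/
theorem enorm_fourierInv_scaledBump (b : ContDiffBump (0 : Rd d)) (ξ₀ : Rd d) {l : ℝ}
    (hl : 0 < l) (x : Rd d) :
    ‖𝓕⁻ (scaledBump b ξ₀ l hl) x‖ₑ =
      ENNReal.ofReal l ^ d * ‖𝓕⁻ (scaledBump b 0 1 one_pos) (l • x)‖ₑ := by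
  have h1 : 𝓕⁻ (scaledBump b ξ₀ l hl) x = (Real.fourierChar (inner ℝ ξ₀ x) : ℂ) *
      ((l ^ d : ℝ) • 𝓕⁻ (scaledBump b 0 1 one_pos) (l • x)) := by
    rw [SchwartzMap.fourierInv_coe, SchwartzMap.fourierInv_coe, Real.fourierInv_eq,
      Real.fourierInv_eq]
    set g : Rd d → ℂ := fun η => Real.fourierChar (inner ℝ η (l • x)) •
      scaledBump b 0 1 one_pos η with hg
    have e : ∀ ξ, Real.fourierChar (inner ℝ ξ x) • scaledBump b ξ₀ l hl ξ =
        (Real.fourierChar (inner ℝ ξ₀ x) : ℂ) * g (l⁻¹ • (ξ - ξ₀)) := by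
      intro ξ
      have e1 : inner ℝ ξ x = inner ℝ ξ₀ x + inner ℝ (l⁻¹ • (ξ - ξ₀)) (l • x) := by
        rw [inner_smul_left, inner_smul_right, inner_sub_left]
        simp only [conj_trivial]
        field_simp
        ring
      have e2 : scaledBump b 0 1 one_pos (l⁻¹ • (ξ - ξ₀)) = scaledBump b ξ₀ l hl ξ := by
        change ((b ((1 : ℝ)⁻¹ • (l⁻¹ • (ξ - ξ₀) - 0)) : ℝ) : ℂ) = ((b (l⁻¹ • (ξ - ξ₀)) : ℝ) : ℂ)
        simp
      rw [hg]
      simp only [e2]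
      rw [e1, AddChar.map_add_eq_mul, Circle.smul_def, Circle.smul_def, Circle.coe_mul,
        smul_eq_mul, smul_eq_mul, mul_assoc]
    simp only [e]
    rw [integral_const_mul, integral_sub_right_eq_self (fun ξ => g (l⁻¹ • ξ)) ξ₀,
      Measure.integral_comp_smul]
    simp [abs_of_pos hl]
  rw [h1, enorm_mul, enorm_smul, ← ofReal_norm, Circle.norm_coe, ENNReal.ofReal_one, one_mul,
    ← ofReal_norm (l ^ d : ℝ), Real.norm_eq_abs, abs_of_pos (by positivity),
    ENNReal.ofReal_pow hl.le]

theorem lintegral_rpow_enorm_scaledBump (b : ContDiffBump (0 : Rd d)) (ξ₀ : Rd d) {l : ℝ}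
    (hl : 0 < l) {p : ℝ} (hp : 0 < p) :
    (∫⁻ x, ‖𝓕⁻ (scaledBump b ξ₀ l hl) x‖ₑ ^ p) ^ (1 / p) =
      ENNReal.ofReal l ^ (d - d / p : ℝ) *
        (∫⁻ x, ‖𝓕⁻ (scaledBump b 0 1 one_pos) x‖ₑ ^ p) ^ (1 / p) := by
  have hl0 : ENNReal.ofReal l ≠ 0 := (ENNReal.ofReal_pos.2 hl).ne'
  simp_rw [enorm_fourierInv_scaledBump b ξ₀ hl, ENNReal.mul_rpow_of_nonneg _ _ hp.le]
  have hm : Measurable fun x : Rd d => ‖𝓕⁻ (scaledBump b 0 1 one_pos) x‖ₑ ^ p :=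
    (𝓕⁻ (scaledBump b 0 1 one_pos)).continuous.measurable.enorm.pow_const p
  rw [lintegral_const_mul' _ _ (ENNReal.rpow_ne_top_of_nonneg hp.le
    (ENNReal.pow_ne_top ENNReal.ofReal_ne_top)),
    ← lintegral_map hm (measurable_const_smul l), Measure.map_addHaar_smul volume hl.ne',
    lintegral_smul_measure, smul_eq_mul, ← mul_assoc,
    ENNReal.mul_rpow_of_nonneg _ _ (by positivity)]
  congr 1
  rw [abs_of_pos (by positivity), ENNReal.ofReal_inv_of_pos (by positivity),
    ENNReal.ofReal_pow hl.le, finrank_euclideanSpace_fin, ← ENNReal.rpow_natCast,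
    ← ENNReal.rpow_mul, ← ENNReal.rpow_neg, ← ENNReal.rpow_add _ _ hl0 ENNReal.ofReal_ne_top,
    ← ENNReal.rpow_mul]
  congr 1
  field_simp
  ring

theorem lintegral_rpow_enorm_scaledBump_ne_zero (b : ContDiffBump (0 : Rd d)) {p : ℝ}
    (hp : 0 < p) :
    (∫⁻ x, ‖𝓕⁻ (scaledBump b 0 1 one_pos) x‖ₑ ^ p) ^ (1 / p) ≠ 0 := by
  set ψ := 𝓕⁻ (scaledBump b 0 1 one_pos) with hψ
  intro h
  rw [ENNReal.rpow_eq_zero_iff_of_pos (by positivity), lintegral_eq_zero_iff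
    (ψ.continuous.measurable.enorm.pow_const p)] at h
  have h1 : (ψ : Rd d → ℂ) =ᵐ[volume] fun _ => 0 := by
    filter_upwards [h] with x hx
    simpa [ENNReal.rpow_eq_zero_iff_of_pos hp] using hx
  have h2 := (Continuous.ae_eq_iff_eq volume ψ.continuous continuous_const).1 h1
  have h3 : ψ = 0 := by ext x; exact congr_fun h2 x
  have h4 : scaledBump b 0 1 one_pos = 0 :=
    calc scaledBump b 0 1 one_pos = 𝓕 ψ := (FourierTransform.fourier_fourierInv_eq _).symm
      _ = 0 := by rw [h3]; exact FourierTransform.fourier_zero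
  have h5 : scaledBump b 0 1 one_pos 0 = 1 := by
    change ((b ((1 : ℝ)⁻¹ • ((0 : Rd d) - 0)) : ℝ) : ℂ) = 1
    simp [b.one_of_mem_closedBall (Metric.mem_closedBall_self b.rIn_pos.le)]
  rw [h4] at h5
  simp at h5

/-! ### Symbols on dyadic shells -/

/-- The set of radii on which exactly the `n`-th function of a dyadic decomposition lives. -/
def InShell (n : ℕ) (s : ℝ) : Prop := (n = 0 ∧ s < 1) ∨ (1 ≤ n ∧ 3 / 4 * 2 ^ n < s ∧ s < 2 ^ n)

/-- On the shell, `φ (2 ^ (-i) x)` is `1` for `i ≥ n` and `0` for `i < n`, because `3/4 * 2 ^ n =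
3/2 * 2 ^ (n - 1)`. The differences therefore see a single jump, at `n`. -/
theorem dyadic_eq_ite {V : Type} [NormedAddCommGroup V] [NormedSpace ℝ V] {φ : V → ℂ}
    (h1 : ∀ x, ‖x‖ ≤ 1 → φ x = 1) (h0 : ∀ x, 3 / 2 < ‖x‖ → φ x = 0) {n : ℕ} {x : V}
    (hx : InShell n ‖x‖) (j : ℕ) : dyadic φ j x = if j = n then 1 else 0 := by
  have hn : ∀ i : ℕ, ‖((2 : ℝ) ^ i)⁻¹ • x‖ = ‖x‖ / 2 ^ i := fun i => by
    rw [norm_smul, norm_inv, norm_pow, Real.norm_ofNat, div_eq_inv_mul]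
  have hone : ∀ i : ℕ, ‖x‖ ≤ 2 ^ i → φ (((2 : ℝ) ^ i)⁻¹ • x) = 1 := fun i hi =>
    h1 _ (by rw [hn, div_le_one (by positivity)]; exact hi)
  have hzero : ∀ i : ℕ, 3 / 2 * 2 ^ i < ‖x‖ → φ (((2 : ℝ) ^ i)⁻¹ • x) = 0 := fun i hi =>
    h0 _ (by rw [hn, lt_div_iff₀ (by positivity)]; exact hi)
  have hle : ∀ {a b : ℕ}, a ≤ b → (2 : ℝ) ^ a ≤ 2 ^ b := fun h =>
    pow_le_pow_right₀ one_le_two h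
  rcases hx with ⟨rfl, hx⟩ | ⟨hn1, hx1, hx2⟩
  · cases j with
    | zero => exact (h1 x hx.le).trans (if_pos rfl).symm
    | succ j =>
      simp only [dyadic, Nat.add_eq_zero_iff, one_ne_zero, and_false, if_false]
      have := one_le_pow₀ (one_le_two (α := ℝ)) (n := j)
      have := one_le_pow₀ (one_le_two (α := ℝ)) (n := j + 1)
      rw [hone _ (by linarith), hone _ (by linarith), sub_self]
  · cases j with
    | zero =>
      rw [if_neg (by omega)]
      refine h0 x ?_
      have := hle hn1
      linarith
    | succ j =>
      simp only [dyadic]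
      have e : (2 : ℝ) ^ (j + 1) = 2 * 2 ^ j := by ring
      rcases lt_trichotomy (j + 1) n with h | h | h
      · rw [if_neg h.ne, hzero, hzero, sub_self]
        · have := hle (a := j + 1) (b := n) (by omega)
          linarith
        · have := hle (a := j + 1 + 1) (b := n) (by omega)
          rw [pow_succ] at this
          linarith
      · rw [if_pos h, hone, hzero, sub_zero]
        · rw [← h] at hx1
          linarith
        · rw [h]; exact hx2.le
      · have := hle (a := n) (b := j) (by omega)
        have : (0 : ℝ) < 2 ^ j := by positivity
        rw [if_neg h.ne', hone _ (by linarith), hone _ (by linarith), sub_self]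

theorem isoSymbol_eq_ite {φ₀ : 𝓢(Rd d, ℝ)} (hφ₀ : IsIsotropicGenerator φ₀) {n : ℕ} {x : Rd d}
    (hx : InShell n ‖x‖) (j : ℕ) : isoSymbol φ₀ j x = if j = n then 1 else 0 :=
  dyadic_eq_ite (fun x hx => by rw [hφ₀.eq_one x hx, Complex.ofReal_one])
    (fun x hx => by rw [hφ₀.eq_zero x hx.le, Complex.ofReal_zero]) hx j

theorem mixSymbol_eq_ite {η₀ : ℝ → ℂ} (h0 : IsUnivariateGenerator η₀) {n : Fin d → ℕ} {x : Rd d}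
    (hx : ∀ i, InShell (n i) |x i|) (k : Fin d → ℕ) :
    mixSymbol η₀ k x = if k = n then 1 else 0 := by
  have h : ∀ i, dyadic η₀ (k i) (x i) = if k i = n i then 1 else 0 := fun i =>
    dyadic_eq_ite (fun x hx => h0.apply_eq_one hx) (fun x hx => h0.eq_zero hx) (hx i) (k i)
  simp only [mixSymbol, h]
  split_ifs with hk
  · exact Finset.prod_eq_one fun i _ => by rw [hk, if_pos rfl]
  · obtain ⟨i, hi⟩ := Function.ne_iff.1 hk
    exact Finset.prod_eq_zero (Finset.mem_univ i) (if_neg hi)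

end Necessity

section NecessaryConditions

open scoped FourierTransform
open Filter Topology

variable {d : ℕ}

/-! ### Necessary conditions -/

theorem exponent_le_of_forall_rpow_mul_le {a b : ℝ} {A B C : ℝ≥0∞} (hA : A ≠ 0) (hB : B ≠ ⊤)
    (hC : C ≠ ⊤) (n₀ : ℕ)
    (h : ∀ n : ℕ, n₀ ≤ n → (2 : ℝ≥0∞) ^ (n * a) * A ≤ C * (2 ^ (n * b) * B)) : a ≤ b := by
  by_contra! hab
  have hc : 0 < a - b := sub_pos.2 hab
  have h2 : ∀ n : ℕ, n₀ ≤ n → (2 : ℝ≥0∞) ^ (n * (a - b)) ≤ C * B / A := by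
    intro n hn
    rw [ENNReal.le_div_iff_mul_le (Or.inl hA) (Or.inr (ENNReal.mul_ne_top hC hB))]
    have e : (n : ℝ) * (a - b) = -(n * b) + n * a := by ring
    calc (2 : ℝ≥0∞) ^ (n * (a - b)) * A = 2 ^ (-(n * b)) * (2 ^ (n * a) * A) := by
          rw [e, ENNReal.rpow_add _ _ (by simp) (by simp), mul_assoc]
      _ ≤ 2 ^ (-(n * b)) * (C * (2 ^ (n * b) * B)) := mul_le_mul_right (h n hn) _
      _ = (2 ^ (-(n * b)) * 2 ^ (n * b)) * (C * B) := by ring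
      _ = C * B := by
          rw [← ENNReal.rpow_add _ _ (by simp) (by simp)]
          simp
  have hM : C * B / A ≠ ⊤ := ENNReal.div_ne_top (ENNReal.mul_ne_top hC hB) hA
  obtain ⟨j, hj⟩ := ENNReal.exists_nat_gt hM
  obtain ⟨n, hn⟩ := exists_nat_ge (j / (a - b))
  have hn' : (j : ℝ) ≤ n * (a - b) := (div_le_iff₀ hc).1 hn
  refine absurd (h2 (max n n₀) (le_max_right _ _)) (not_le.2 (hj.trans_le ?_))
  calc (j : ℝ≥0∞) ≤ 2 ^ j := by exact_mod_cast Nat.lt_two_pow_self.le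
    _ = 2 ^ (j : ℝ) := (ENNReal.rpow_natCast _ _).symm
    _ ≤ _ := by
        refine ENNReal.rpow_le_rpow_of_exponent_le (by norm_num) (hn'.trans ?_)
        gcongr
        exact le_max_left _ _

/-- The embedding inequality for a sum whose terms each lie in a single isotropic and a single mixed
piece; injectivity of `j` and `κ` keeps the pieces distinct, so both sides are explicit. -/
theorem test_of_embeds {φ₀ : 𝓢(Rd d, ℝ)} (hφ₀ : IsIsotropicGenerator φ₀) {η₀ : ℝ → ℂ}
    (hη₀ : IsUnivariateGenerator η₀) {p p₀ : ℝ} (hp : 0 < p) (hp₀ : 0 < p₀) {q q₀ : ℝ≥0∞}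
    (hq : 0 < q) (hq₀ : 0 < q₀) {σ t₀ : ℝ} {C : ℝ≥0}
    (hC : ∀ f ∈ space (normF φ₀ σ p q), normSF η₀ t₀ p₀ q₀ f ≤ C * normF φ₀ σ p q f)
    {S : Finset ℕ} (hS : S.Nonempty) {F : ℕ → 𝓢(Rd d, ℂ)} {κ : ℕ → Fin d → ℕ} {j : ℕ → ℕ}
    (hj : Set.InjOn j S) (hκ : Set.InjOn κ S)
    (hF : ∀ n ∈ S, ∀ ξ, 𝓕 (F n) ξ ≠ 0 → InShell (j n) ‖(2 * Real.pi) • ξ‖ ∧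
      ∀ i, InShell (κ n i) |((2 * Real.pi) • ξ) i|)
    {V V₀ : ℝ≥0∞} (hV : V ≠ ⊤) (hV₀ : V₀ ≠ ⊤) {Φ : Rd d → ℝ≥0∞}
    (hΦ : ∀ n ∈ S, ∀ x, (2 : ℝ≥0∞) ^ ((j n : ℝ) * σ) * ‖F n x‖ₑ = V * Φ x)
    (hΦ₀ : ∀ n ∈ S, ∀ x, (2 : ℝ≥0∞) ^ (((∑ i, κ n i : ℕ) : ℝ) * t₀) * ‖F n x‖ₑ = V₀ * Φ x)
    (hfin : (∫⁻ x, Φ x ^ p) ^ (1 / p) ≠ ⊤) :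
    (S.card : ℝ≥0∞) ^ (1 / q₀.toReal) * V₀ * (∫⁻ x, Φ x ^ p₀) ^ (1 / p₀) ≤
      C * ((S.card : ℝ≥0∞) ^ (1 / q.toReal) * V * (∫⁻ x, Φ x ^ p) ^ (1 / p)) := by
  have e1 := distLpLqNorm_test hp hq (w := fun j : ℕ => (2 : ℝ≥0∞) ^ ((j : ℝ) * σ))
    (m := isoSymbol φ₀) (isoSymbol_hasTemperateGrowth φ₀) hS hj (F := F) (fun n hn k ξ => by
      by_cases h : 𝓕 (F n) ξ = 0
      · simp [h]
      · rw [isoSymbol_eq_ite hφ₀ (hF n hn ξ h).1]) hV hΦ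
  have e2 := distLpLqNorm_test hp₀ hq₀
    (w := fun k : Fin d → ℕ => (2 : ℝ≥0∞) ^ (((∑ i, k i : ℕ) : ℝ) * t₀))
    (m := mixSymbol η₀) (mixSymbol_hasTemperateGrowth hη₀) hS hκ (F := F) (fun n hn k ξ => by
      by_cases h : 𝓕 (F n) ξ = 0
      · simp [h]
      · rw [mixSymbol_eq_ite hη₀ (hF n hn ξ h).2]) hV₀ hΦ₀
  rw [← e1, ← e2]
  refine hC _ ?_
  change distLpLqNorm _ _ _ _ < ⊤
  rw [e1]
  exact (ENNReal.mul_ne_top (ENNReal.mul_ne_top (ENNReal.rpow_ne_top_of_nonneg (by positivity)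
    (by simp)) hV) hfin).lt_top

/-- There are directions along which the isotropic and the mixed decompositions both have a
single active piece. -/
theorem exists_direction (hd : 0 < d) : ∃ (m : ℕ) (e : ℝ) (v : Rd d) (δ : ℝ) (κ : ℕ → Fin d → ℕ),
    0 < δ ∧ Function.Injective κ ∧ (∀ n, m < n → ((∑ i, κ n i : ℕ) : ℝ) = d * n - e) ∧
    ∀ n, m < n → ∀ x : Rd d, ‖x - (2 : ℝ) ^ n • v‖ ≤ 2 ^ n * δ →
      InShell n ‖x‖ ∧ ∀ i, InShell (κ n i) |x i| := by
  -- One dominant coordinate `7/8`, the midpoint of `(3/4, 1)`, and the others smaller by `2 ^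
  -- (-m)`. Then the Euclidean norm stays so close to the first coordinate that both lie in shell
  -- `n`, while the others lie in shell `n - m`; `d * ε ≤ 1/16` ensures this. The total `n + (d - 1)
  -- * (n - m)` explains `e`.
  set m := d + 4 with hm
  set ε : ℝ := (2 ^ m)⁻¹ with hε
  have hε0 : 0 < ε := by positivity
  have hdε : d * ε ≤ 1 / 16 := by
    rw [hε, ← div_eq_mul_inv, div_le_iff₀ (by positivity)]
    have : (d : ℝ) ≤ 2 ^ d := by exact_mod_cast Nat.lt_two_pow_self.le
    rw [hm, pow_add]
    linarith
  have hd1 : (1 : ℝ) ≤ d := by exact_mod_cast hd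
  have hε1 : ε ≤ 1 / 16 := by nlinarith
  let i₀ : Fin d := ⟨0, hd⟩
  let v : Rd d := WithLp.toLp 2 fun i => if i = i₀ then 7 / 8 else 7 / 8 * ε
  let κ : ℕ → Fin d → ℕ := fun n i => if i = i₀ then n else n - m
  refine ⟨m, (d - 1) * m, v, ε / 16, κ, by positivity, ?_, ?_, ?_⟩
  · intro a b hab
    simpa [κ] using congr_fun hab i₀
  · intro n hn
    have : ∀ i, ((κ n i : ℕ) : ℝ) = (n - m) + if i = i₀ then (m : ℝ) else 0 := by
      intro i
      by_cases hi : i = i₀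
      · simp [κ, hi]
      · simp [κ, hi, Nat.cast_sub hn.le]
    push_cast
    simp only [this, Finset.sum_add_distrib, Finset.sum_const, Finset.card_univ, Fintype.card_fin,
      nsmul_eq_mul, Finset.sum_ite_eq', Finset.mem_univ, if_true]
    ring
  · intro n hn x hx
    have h2 : (0 : ℝ) < 2 ^ n := by positivity
    have hcoord : ∀ i, |x i - 2 ^ n * v i| ≤ 2 ^ n * (ε / 16) := fun i => by
      have := (PiLp.norm_apply_le (x - (2 : ℝ) ^ n • v) i).trans hx
      simpa using this
    have hshell : ∀ (i : Fin d) (c : ℝ), 0 < c → v i = 7 / 8 * c → ε ≤ c →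
        3 / 4 * (2 ^ n * c) < |x i| ∧ |x i| < 2 ^ n * c := by
      intro i c hc hv hεc
      have h := abs_le.1 (hcoord i)
      rw [hv] at h
      have h3 : 0 < 2 ^ n * c := by positivity
      have h4 : 2 ^ n * ε ≤ 2 ^ n * c := by gcongr
      have h5 : 0 < x i := by linarith
      rw [abs_of_pos h5]
      constructor <;> linarith
    have hfirst := hshell i₀ 1 one_pos (by simp [v]) (by linarith)
    rw [mul_one] at hfirst
    refine ⟨Or.inr ⟨by omega, ?_, ?_⟩, fun i => ?_⟩
    · exact hfirst.1.trans_le (PiLp.norm_apply_le x i₀)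
    · have hv : ‖v‖ ≤ 9 / 10 := by
        rw [EuclideanSpace.norm_eq, Real.sqrt_le_left (by norm_num)]
        calc ∑ i, ‖v i‖ ^ 2 ≤ ∑ i : Fin d, ((if i = i₀ then 49 / 64 else 0) + 49 / 64 * ε ^ 2) := by
              refine Finset.sum_le_sum fun i _ => ?_
              by_cases hi : i = i₀
              · simp only [v, hi, if_true, Real.norm_eq_abs, sq_abs]
                nlinarith [sq_nonneg ε]
              · simp only [v, hi, if_false, Real.norm_eq_abs, sq_abs]
                nlinarith [sq_nonneg ε]
          _ = 49 / 64 + 49 / 64 * ((d * ε) * ε) := by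
              simp [Finset.sum_add_distrib]
              ring
          _ ≤ (9 / 10) ^ 2 := by nlinarith
      calc ‖x‖ = ‖(x - (2 : ℝ) ^ n • v) + (2 : ℝ) ^ n • v‖ := by rw [sub_add_cancel]
        _ ≤ 2 ^ n * (ε / 16) + 2 ^ n * (9 / 10) := by
            refine (norm_add_le _ _).trans (add_le_add hx ?_)
            rw [norm_smul, norm_pow, Real.norm_ofNat]
            gcongr
        _ < 2 ^ n := by nlinarith
    · by_cases hi : i = i₀
      · subst hi
        simp only [κ, if_true]
        exact Or.inr ⟨by omega, hfirst⟩
      · have h := hshell i ε hε0 (by simp [v, hi]) le_rfl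
        have e : (2 : ℝ) ^ n * ε = 2 ^ (n - m) := by
          rw [hε, pow_sub₀ _ two_ne_zero hn.le]
        rw [e] at h
        simp only [κ, hi, if_false]
        exact Or.inr ⟨by omega, h⟩

theorem necessary_conditions (hd : 0 < d) {φ₀ : 𝓢(Rd d, ℝ)} (hφ₀ : IsIsotropicGenerator φ₀)
    {η₀ : ℝ → ℂ} (hη₀ : IsUnivariateGenerator η₀) {p p₀ : ℝ} (hp : 0 < p) (hp₀ : 0 < p₀)
    {q q₀ : ℝ≥0∞} (hq : 0 < q) (hq₀ : 0 < q₀) {t t₀ : ℝ}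
    (hemb : Embeds (normF φ₀ (t * d) p q) (normSF η₀ t₀ p₀ q₀)) :
    p ≤ p₀ ∧ t₀ - 1 / p₀ ≤ t - 1 / p ∧ (p = p₀ → t = t₀ → q ≤ q₀) := by
  obtain ⟨-, C, hC⟩ := hemb
  have hd' : (0 : ℝ) < d := by exact_mod_cast hd
  have hCt : (C : ℝ≥0∞) ≠ ⊤ := ENNReal.coe_ne_top
  have two_rpow : ∀ a : ℝ, (2 : ℝ≥0∞) ^ a ≠ ⊤ := fun a =>
    ENNReal.rpow_ne_top_of_ne_zero (by norm_num) (by norm_num)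
  have two_rpow0 : ∀ a : ℝ, (2 : ℝ≥0∞) ^ a ≠ 0 := fun a =>
    (ENNReal.rpow_pos (by norm_num) (by norm_num)).ne'
  have hpi := Real.pi_pos
  have hmul : ∀ (ξ : Rd d), ‖(2 * Real.pi) • ξ‖ = 2 * Real.pi * ‖ξ‖ := fun ξ => by
    rw [norm_smul, Real.norm_eq_abs, abs_of_pos (by positivity)]
  have hψ : ∀ (b : ContDiffBump (0 : Rd d)) (r : ℝ), 0 < r →
      (∫⁻ x, ‖𝓕⁻ (scaledBump b 0 1 one_pos) x‖ₑ ^ r) ^ (1 / r) ≠ ⊤ := fun b r hr =>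
    ENNReal.rpow_ne_top_of_nonneg (by positivity) (lintegral_rpow_enorm_lt_top _ hr).ne
  refine ⟨?_, ?_, ?_⟩
  -- Bumps of width about `2 ^ (-n)` at the origin involve only the pieces of index `0`, so both
  -- norms are plain `L_p` norms; `1/20` is chosen so that `2π / 20 < 1`.
  · let b : ContDiffBump (0 : Rd d) := ⟨1 / 40, 1 / 20, by norm_num, by norm_num⟩
    have key : (d / p₀ : ℝ) - d ≤ d / p - d := by
      refine exponent_le_of_forall_rpow_mul_le
        (lintegral_rpow_enorm_scaledBump_ne_zero b hp₀) (hψ b p hp) hCt 0 fun n _ => ?_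
      have hl : (0 : ℝ) < ((2 : ℝ) ^ n)⁻¹ := by positivity
      have hlp : ∀ r : ℝ, ENNReal.ofReal ((2 : ℝ) ^ n)⁻¹ ^ (d - d / r : ℝ) =
          2 ^ (n * ((d / r : ℝ) - d)) := by
        intro r
        rw [ENNReal.ofReal_inv_of_pos (by positivity), ENNReal.ofReal_pow (by norm_num),
          ENNReal.ofReal_ofNat, ← ENNReal.rpow_natCast, ← ENNReal.rpow_neg, ← ENNReal.rpow_mul]
        congr 1
        ring
      have h := test_of_embeds hφ₀ hη₀ hp hp₀ hq hq₀ hC (S := {0}) (by simp)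
        (F := fun _ => 𝓕⁻ (scaledBump b 0 _ hl)) (κ := fun _ _ => 0) (j := fun _ => 0)
        (by simp) (by simp) (fun _ _ ξ hξ => by
          rw [FourierTransform.fourier_fourierInv_eq] at hξ
          have h1 := norm_sub_le_of_scaledBump_ne_zero hξ
          have h2 : ((2 : ℝ) ^ n)⁻¹ * b.rOut ≤ 1 / 20 := by
            change ((2 : ℝ) ^ n)⁻¹ * (1 / 20) ≤ 1 / 20
            exact mul_le_of_le_one_left (by norm_num)
              (inv_le_one_of_one_le₀ (one_le_pow₀ one_le_two))
          rw [sub_zero] at h1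
          have h3 : ‖(2 * Real.pi) • ξ‖ < 1 := by
            rw [hmul]
            have := Real.pi_lt_d2
            nlinarith [norm_nonneg ξ]
          exact ⟨Or.inl ⟨rfl, h3⟩, fun i => Or.inl ⟨rfl, (PiLp.norm_apply_le _ i).trans_lt h3⟩⟩)
        (V := 1) (V₀ := 1) (by simp) (by simp)
        (Φ := fun x => ‖𝓕⁻ (scaledBump b 0 _ hl) x‖ₑ) (by simp) (by simp)
        (ENNReal.rpow_ne_top_of_nonneg (by positivity) (lintegral_rpow_enorm_lt_top _ hp).ne)
      rw [lintegral_rpow_enorm_scaledBump b 0 hl hp, lintegral_rpow_enorm_scaledBump b 0 hl hp₀,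
        hlp, hlp] at h
      simpa using h
    have h1 : d / p₀ ≤ d / p := by linarith
    rwa [div_le_div_iff_of_pos_left hd' hp₀ hp] at h1
  -- Both remaining conditions use bumps around `2 ^ n • v`, rescaled by `2π` in the frequency
  -- variable. Every width up to `2 ^ n` stays in the prescribed shells.
  all_goals
    obtain ⟨m, e, v, δ, κ, hδ, hκ, hsum, hdir⟩ := exists_direction hd
    let b : ContDiffBump (0 : Rd d) := ⟨δ / (4 * Real.pi), δ / (2 * Real.pi), by positivity, by
      gcongr; norm_num⟩
    have hshell : ∀ n, m < n → ∀ (l : ℝ) (hl : 0 < l), l ≤ 2 ^ n → ∀ ξ,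
        scaledBump b ((2 * Real.pi)⁻¹ • (2 : ℝ) ^ n • v) l hl ξ ≠ 0 →
        InShell n ‖(2 * Real.pi) • ξ‖ ∧ ∀ i, InShell (κ n i) |((2 * Real.pi) • ξ) i| := by
      intro n hn l hl hln ξ hξ
      have h1 : ‖ξ - (2 * Real.pi)⁻¹ • (2 : ℝ) ^ n • v‖ ≤ l * (δ / (2 * Real.pi)) :=
        norm_sub_le_of_scaledBump_ne_zero hξ
      refine hdir n hn _ ?_
      have h2 : (2 * Real.pi) • ξ - (2 : ℝ) ^ n • v =
          (2 * Real.pi) • (ξ - (2 * Real.pi)⁻¹ • (2 : ℝ) ^ n • v) := by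
        rw [smul_sub, smul_inv_smul₀ (by positivity)]
      rw [h2, hmul]
      calc 2 * Real.pi * ‖ξ - (2 * Real.pi)⁻¹ • (2 : ℝ) ^ n • v‖
          ≤ 2 * Real.pi * (2 ^ n * (δ / (2 * Real.pi))) := by
            gcongr
            exact h1.trans (by gcongr)
        _ = 2 ^ n * δ := by field_simp
  -- A single bump of the full width `2 ^ n`: the exponents of `2 ^ n` in the two norms are
  -- compared, and dividing by `d` gives the condition.
  · have key : d * t₀ + (d - d / p₀) ≤ t * d + (d - d / p) := by
      refine exponent_le_of_forall_rpow_mul_le (A := 2 ^ (-(e * t₀)) *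
        (∫⁻ x, ‖𝓕⁻ (scaledBump b 0 1 one_pos) x‖ₑ ^ p₀) ^ (1 / p₀))
        (mul_ne_zero (two_rpow0 _) (lintegral_rpow_enorm_scaledBump_ne_zero b hp₀))
        (hψ b p hp) hCt (m + 1) fun n hn => ?_
      have hl : (0 : ℝ) < (2 : ℝ) ^ n := by positivity
      have hlp : ∀ r : ℝ, ENNReal.ofReal ((2 : ℝ) ^ n) ^ (d - d / r : ℝ) =
          2 ^ (n * (d - d / r : ℝ)) := by
        intro r
        rw [ENNReal.ofReal_pow (by norm_num),
          ENNReal.ofReal_ofNat, ← ENNReal.rpow_natCast, ← ENNReal.rpow_mul]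
      have h := test_of_embeds hφ₀ hη₀ hp hp₀ hq hq₀ hC (S := {n}) (by simp)
        (F := fun _ => 𝓕⁻ (scaledBump b ((2 * Real.pi)⁻¹ • (2 : ℝ) ^ n • v) _ hl))
        (κ := κ) (j := id) (by simp) (by simp) (fun n' hn' ξ hξ => by
          rw [FourierTransform.fourier_fourierInv_eq] at hξ
          rw [Finset.mem_singleton.1 hn']
          exact hshell n hn _ hl le_rfl ξ hξ)
        (V := 2 ^ ((n : ℝ) * (t * d))) (V₀ := 2 ^ ((d * n - e) * t₀)) (two_rpow _) (two_rpow _)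
        (Φ := fun x => ‖𝓕⁻ (scaledBump b ((2 * Real.pi)⁻¹ • (2 : ℝ) ^ n • v) _ hl) x‖ₑ)
        (fun n' hn' x => by rw [Finset.mem_singleton.1 hn']; rfl)
        (fun n' hn' x => by rw [Finset.mem_singleton.1 hn', hsum n hn])
        (ENNReal.rpow_ne_top_of_nonneg (by positivity) (lintegral_rpow_enorm_lt_top _ hp).ne)
      rw [lintegral_rpow_enorm_scaledBump b _ hl hp, lintegral_rpow_enorm_scaledBump b _ hl hp₀,
        hlp, hlp, Finset.card_singleton, Nat.cast_one, ENNReal.one_rpow, ENNReal.one_rpow,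
        one_mul, one_mul, ← mul_assoc, ← mul_assoc (2 ^ _ : ℝ≥0∞) (2 ^ _),
        ← ENNReal.rpow_add _ _ (by simp) (by simp),
        ← ENNReal.rpow_add _ _ (by simp) (by simp), ← mul_add] at h
      refine le_trans (le_of_eq ?_) h
      rw [← mul_assoc, ← ENNReal.rpow_add _ _ (by simp) (by simp)]
      congr 2
      ring
    have h1 : d * (t₀ - 1 / p₀) ≤ d * (t - 1 / p) := by
      have e1 : d * (t₀ - 1 / p₀) = d * t₀ + (d - d / p₀) - d := by ring
      have e2 : d * (t - 1 / p) = t * d + (d - d / p) - d := by ring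
      linarith
    exact le_of_mul_le_mul_left h1 hd'
  -- Here `2 ^ n` bumps of unit width, normalized by `2 ^ (-n' t d)`, give equal moduli in distinct
  -- pieces. The norms are `2 ^ (n / q)` and `2 ^ (n / q₀)` up to constants.
  · rintro rfl rfl
    have key : 1 / q₀.toReal ≤ 1 / q.toReal := by
      refine exponent_le_of_forall_rpow_mul_le (A := 2 ^ (-(e * t)) *
        (∫⁻ x, ‖𝓕⁻ (scaledBump b 0 1 one_pos) x‖ₑ ^ p) ^ (1 / p))
        (mul_ne_zero (two_rpow0 _) (lintegral_rpow_enorm_scaledBump_ne_zero b hp₀))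
        (hψ b p hp) hCt 0 fun n _ => ?_
      have hnorm : ∀ (n' : ℕ) (x : Rd d), ‖((((2 : ℝ) ^ (-(n' * (t * d)) : ℝ) : ℝ) : ℂ) •
          𝓕⁻ (scaledBump b ((2 * Real.pi)⁻¹ • (2 : ℝ) ^ n' • v) 1 one_pos)) x‖ₑ =
          (2 : ℝ≥0∞) ^ (-(n' * (t * d)) : ℝ) * ‖𝓕⁻ (scaledBump b 0 1 one_pos) x‖ₑ := by
        intro n' x
        rw [smul_apply, enorm_smul, enorm_fourierInv_scaledBump b _ one_pos,
          ← ofReal_norm, Complex.norm_real, Real.norm_eq_abs, abs_of_pos (by positivity),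
          ← ENNReal.ofReal_rpow_of_pos two_pos]
        simp
      have h := test_of_embeds hφ₀ hη₀ hp hp₀ hq hq₀ hC (S := Finset.Ioc m (m + 2 ^ n))
        (by simp)
        (F := fun n' => ((((2 : ℝ) ^ (-(n' * (t * d)) : ℝ) : ℝ) : ℂ) •
          𝓕⁻ (scaledBump b ((2 * Real.pi)⁻¹ • (2 : ℝ) ^ n' • v) 1 one_pos)))
        (κ := κ) (j := id) Function.injective_id.injOn hκ.injOn (fun n' hn' ξ hξ => by
          rw [FourierTransform.fourier_smul, FourierTransform.fourier_fourierInv_eq] at hξ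
          exact hshell n' (Finset.mem_Ioc.1 hn').1 _ one_pos (one_le_pow₀ one_le_two) ξ
            (right_ne_zero_of_mul hξ))
        (V := 1) (V₀ := 2 ^ (-(e * t))) (by simp) (two_rpow _)
        (Φ := fun x => ‖𝓕⁻ (scaledBump b 0 1 one_pos) x‖ₑ)
        (fun n' hn' x => by
          rw [hnorm, ← mul_assoc, ← ENNReal.rpow_add _ _ (by simp) (by simp)]
          simp)
        (fun n' hn' x => by
          rw [hnorm, ← mul_assoc, ← ENNReal.rpow_add _ _ (by simp) (by simp),
            hsum n' (Finset.mem_Ioc.1 hn').1]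
          congr 2
          ring)
        (hψ b p hp)
      have hcard : ((Finset.Ioc m (m + 2 ^ n)).card : ℝ≥0∞) = 2 ^ (n : ℝ) := by
        simp
      rw [hcard, ← ENNReal.rpow_mul, ← ENNReal.rpow_mul, mul_one, mul_assoc] at h
      exact h
    by_cases hq₀t : q₀ = ⊤
    · rw [hq₀t]; exact le_top
    have hq₀' : 0 < q₀.toReal := ENNReal.toReal_pos hq₀.ne' hq₀t
    -- Positivity of `1 / q₀` excludes `q = ∞`, for which `1 / q.toReal` would be `0`.
    have h1 : 0 < 1 / q.toReal := (by positivity : 0 < 1 / q₀.toReal).trans_le key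
    have h2 : 0 < q.toReal := one_div_pos.1 h1
    have hqt : q ≠ ⊤ := (ENNReal.toReal_pos_iff.1 h2).2.ne
    rw [one_div_le_one_div hq₀' h2] at key
    exact (ENNReal.toReal_le_toReal hqt hq₀t).1 key

end NecessaryConditions

end MixedSmoothness

/-! ### The necessary conditions meet the sufficient ones -/

theorem theorem3p13 (d : ℕ) (hd : 2 ≤ d)
    (φ₀ : 𝓢(MixedSmoothness.Rd d, ℝ)) (hφ₀ : MixedSmoothness.IsIsotropicGenerator φ₀)
    (η₀ : ℝ → ℂ) (hη₀ : MixedSmoothness.IsUnivariateGenerator η₀)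
    (p : ℝ) (hp : 0 < p) (q : ℝ≥0∞) (hq : 0 < q) (t : ℝ)
    (p₀ : ℝ) (hp₀ : 0 < p₀) (q₀ : ℝ≥0∞) (hq₀ : 0 < q₀) (t₀ : ℝ)
    (hemb : MixedSmoothness.Embeds
      (MixedSmoothness.normF φ₀ (t * d) p q) (MixedSmoothness.normSF (d := d) η₀ t₀ p₀ q₀)) :
    MixedSmoothness.Embeds
      (MixedSmoothness.normSF (d := d) η₀ t p q) (MixedSmoothness.normSF η₀ t₀ p₀ q₀) := by
  obtain ⟨h1, h2, h3⟩ := MixedSmoothness.necessary_conditions (by omega) hφ₀ hη₀ hp hp₀ hq hq₀ hemb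
  rcases h1.eq_or_lt with rfl | hlt
  · rcases (by linarith : t₀ ≤ t).eq_or_lt with rfl | ht
    · exact MixedSmoothness.embeds_normSF_of_exponent_le hp hq (h3 rfl rfl)
    · exact MixedSmoothness.embeds_normSF_of_smoothness_lt hp ht hq hq₀
  · exact MixedSmoothness.embeds_normSF_of_integrability_lt hη₀ hp hlt h2 hq hq₀
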